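/- For an ordinal $\beta$ (identified with the set of ordinals below $\beta$), let $[\beta]^2$ be the set of two-element subsets of $\beta$. A set $X$ of ordinals is called closed in its supremum if $X\cap\sup X$ is closed in the space of ordinals below $\sup X$ with the order topology. For ordinals $\alpha_0,\alpha_1$, write $\beta\to_{cl}(\alpha_0,\alpha_1)^2$ if for every colouring $c:[\beta]^2\to\{0,1\}$ there are $i\in\{0,1\}$ and a set $X\subseteq\beta$ of order type $\alpha_i$, closed in its supremum, such that every two-element subset of $X$ has colour $i$. If there is an ordinal $\beta$ with $\beta\to_{cl}(\alpha_0,\alpha_1)^2$, the closed ordinal Ramsey number $R^{cl}(\alpha_0,\alpha_1)$ is the least such $\beta$. Then $R^{cl}(\omega\cdot 2,3)$ exists and $$R^{cl}(\omega\cdot 2,3)=\omega^3\cdot 2 .$$ Equivalently, $\omega^3\cdot 2$ is the least ordinal $\beta$ such that for every colouring $c:[\beta]^2\to\{0,1\}$ there is either a three-element subset of $\beta$ all of whose two-element subsets have colour $1$, or a set $X\subseteq\beta$ of order type $\omega\cdot 2$, closed in its supremum, all of whose two-element subsets have colour $0$. -/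

import Mathlib

open Ordinal

universe u v

/-- A set `X` of ordinals, bounded above, is closed in its supremum `sup X`: the trace of `X` on the
ordinal `sup X` (the space of all ordinals below `sup X`, with the order topology) is closed. -/
def ClosedInSup (X : Set Ordinal.{u}) : Prop :=
  IsClosed ((fun γ : Set.Iio (sSup X) => (γ : Ordinal.{u})) ⁻¹' X)

/-- The order type of the set `X` of ordinals is `α`. (Order types of sets of ordinals live one
universe up, hence the lift.) -/
def HasOrderType (X : Set Ordinal.{u}) (α : Ordinal.{u}) : Prop :=
  typeLT X = Ordinal.lift.{u + 1} α

/-- A colouring, with colours in `ι`, of the subsets of `β` of size `n`; the ordinal `β` is the set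
of all ordinals below it. -/
abbrev Colouring (β : Ordinal.{u}) (n : ℕ) (ι : Type v) : Type (max (u + 1) v) :=
  {s : Finset (Set.Iio β) // s.card = n} → ι

/-- Every subset of `X` of size `n` has colour `i` under `c`. -/
def Homogeneous {β : Ordinal.{u}} {n : ℕ} {ι : Type v} (c : Colouring β n ι)
    (X : Set Ordinal.{u}) (i : ι) : Prop :=
  ∀ s : {s : Finset (Set.Iio β) // s.card = n}, (∀ γ ∈ s.1, (γ : Ordinal.{u}) ∈ X) → c s = i

/-- The closed partition relation `β →_cl (α i)^n_{i ∈ ι}`. -/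
def ClosedArrow {ι : Type v} (β : Ordinal.{u}) (α : ι → Ordinal.{u}) (n : ℕ) : Prop :=
  ∀ c : Colouring β n ι, ∃ i : ι, ∃ X : Set Ordinal.{u},
    X ⊆ Set.Iio β ∧ HasOrderType X (α i) ∧ ClosedInSup X ∧ Homogeneous c X i

/-- The closed ordinal Ramsey number `R^cl(α i)^n_{i ∈ ι}` exists and equals `β`. -/
def IsClosedRamseyNumber {ι : Type v} (α : ι → Ordinal.{u}) (n : ℕ) (β : Ordinal.{u}) : Prop :=
  IsLeast {β' : Ordinal.{u} | ClosedArrow β' α n} β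

/-! Read colour 1 as adjacency: the colourings to be understood are triangle-free graphs without an
independent closed copy of `ω * 2`. Such a copy is the same as an increasing sequence, its limit
`p`, and an increasing sequence above `p` (`exists_sequences_of_closedInSup`,
`exists_closedInSup_of_sequences`). The nonzero ordinals below `ω ^ 3 * 2` are the nodes of two
trees: words of length at most three over `ℕ`, a nonleaf node being the limit of its descendants.
The root of the first tree is `ω ^ 3`; the root of the second is out of range.

Upper bound. Ramsey's theorem thins out the labels until adjacency depends only on the trees and on
how the labels interleave (`exists_strictMono_forall_map_iff`). A pattern between nodes of one
length that three nodes can realize pairwise is then never an edge, as it would give a triangle.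
Since independent copies are absent, other edges are forced (`IsCanonicalGraph.edge_cases`): in each
tree any two of the levels of length one, two and three are joined in some pattern. So no node of
the first tree can be joined to two levels of the second. Yet `ω ^ 3`, a limit of every level of the
first tree, together with at most one further node must reach all three levels of the second tree,
and the pigeonhole principle gives a contradiction (`IsCanonicalGraph.false`).

Lower bound. `Vertex.Rel` generates an explicit triangle-free graph. If `β < ω ^ 3 * 2`, first
labels in the second tree are bounded, so an infinite sequence there has unbounded second or third
labels. These large labels force an edge in every candidate copy (`Vertex.exists_adj`). -/

/-! ### Closed copies of `ω * 2` as pairs of sequences. -/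

theorem hasOrderType_omega0_mul_two_iff {X : Set Ordinal.{u}} :
    HasOrderType X (ω * 2) ↔ ∃ f : ℕ ⊕ₗ ℕ → Ordinal.{u}, StrictMono f ∧ Set.range f = X := by
  have key : Ordinal.lift.{u + 1} (ω * 2 : Ordinal.{u}) =
      Ordinal.lift.{u + 1} (type (Sum.Lex ((· < ·) : ℕ → ℕ → Prop) ((· < ·) : ℕ → ℕ → Prop))) := by
    rw [type_sum_lex, type_nat_lt]
    simp [← one_add_one_eq_two, mul_add_one]
  have h2 : HasOrderType X (ω * 2) ↔ Nonempty (X ≃o (ℕ ⊕ₗ ℕ)) := by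
    unfold HasOrderType
    rw [key, ← Ordinal.lift_id'.{0, u + 1} (typeLT X)]
    refine (Ordinal.lift_type_eq.{u + 1, 0, 0}).trans ?_
    exact ⟨fun ⟨e⟩ => ⟨OrderIso.ofRelIsoLT (β := ℕ ⊕ₗ ℕ) e⟩, fun ⟨e⟩ => ⟨e.toRelIsoLT⟩⟩
  rw [h2]
  constructor
  · rintro ⟨e⟩
    refine ⟨fun a => (e.symm a : Ordinal), fun a b h => ?_, ?_⟩
    · exact e.symm.strictMono h
    · ext a
      constructor
      · rintro ⟨b, rfl⟩
        exact (e.symm b).2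
      · intro ha
        exact ⟨e ⟨a, ha⟩, by simp⟩
  · rintro ⟨f, hf, rfl⟩
    exact ⟨(hf.orderIso f).symm⟩

theorem hasOrderType_three_iff {X : Set Ordinal.{u}} : HasOrderType X 3 ↔ X.encard = 3 := by
  unfold HasOrderType
  constructor
  · intro h
    have h1 := congrArg Ordinal.card h
    simp only [card_type, lift_ofNat, card_ofNat] at h1
    rw [Set.encard, ENat.card, h1]
    simp
  · intro h
    have hfin : X.Finite := Set.finite_of_encard_eq_coe (k := 3) (by simpa using h)
    have : Fintype X := hfin.fintype
    rw [type_fintype]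
    have h3 : Fintype.card X = 3 := by
      rw [← Nat.card_eq_fintype_card, Nat.card_coe_set_eq, Set.ncard, h]
      rfl
    simp [h3]

theorem Set.Finite.closedInSup {X : Set Ordinal.{u}} (h : X.Finite) : ClosedInSup X :=
  (h.preimage Subtype.val_injective.injOn).isClosed

/-- A copy of `ω * 2` which is closed in its supremum contains a convergent sequence, its limit, and
an increasing sequence above the limit. -/
theorem exists_sequences_of_closedInSup {X : Set Ordinal.{u}} (h : HasOrderType X (ω * 2))
    (hc : ClosedInSup X) :
    ∃ (x : ℕ → Ordinal.{u}) (p : Ordinal.{u}) (y : ℕ → Ordinal.{u}), StrictMono x ∧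
      IsLUB (Set.range x) p ∧ StrictMono y ∧ (∀ n, p < y n) ∧ (∀ n, x n ∈ X) ∧ p ∈ X ∧
      ∀ n, y n ∈ X := by
  obtain ⟨f, hf, rfl⟩ := hasOrderType_omega0_mul_two_iff.1 h
  set x : ℕ → Ordinal.{u} := fun n => f (toLex (Sum.inl n)) with hx
  set y : ℕ → Ordinal.{u} := fun n => f (toLex (Sum.inr n)) with hy
  have hxm : StrictMono x := fun a b hab => hf (Sum.Lex.inl_lt_inl_iff.2 hab)
  have hym : StrictMono y := fun a b hab => hf (Sum.Lex.inr_lt_inr_iff.2 hab)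
  have hxy : ∀ m n, x m < y n := fun m n => hf (Sum.Lex.inl_lt_inr _ _)
  have hbx : BddAbove (Set.range x) := ⟨y 0, by rintro _ ⟨n, rfl⟩; exact (hxy n 0).le⟩
  have hlub : IsLUB (Set.range x) (sSup (Set.range x)) := isLUB_csSup ⟨_, 0, rfl⟩ hbx
  set s := sSup (Set.range x) with hs
  have hbX : BddAbove (Set.range f) := Ordinal.bddAbove_of_small
  have hsy : s ≤ y 0 := hlub.2 (by rintro _ ⟨n, rfl⟩; exact (hxy n 0).le)
  have hsX : s < sSup (Set.range f) :=
    (hsy.trans_lt (hym (Nat.zero_lt_one))).trans_le (le_csSup hbX ⟨_, rfl⟩)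
  have hmem : (⟨s, hsX⟩ : Set.Iio (sSup (Set.range f))) ∈
      (fun γ : Set.Iio (sSup (Set.range f)) => (γ : Ordinal.{u})) ⁻¹' (Set.range f) := by
    have hxs : ∀ n, x n < s := fun n => (hxm (Nat.lt_succ_self n)).trans_le (hlub.1 ⟨_, rfl⟩)
    have htend : Filter.Tendsto x Filter.atTop (nhds s) := tendsto_atTop_isLUB hxm.monotone hlub
    have htend' : Filter.Tendsto
        (fun n => (⟨x n, (hxs n).trans hsX⟩ : Set.Iio (sSup (Set.range f)))) Filter.atTop
        (nhds ⟨s, hsX⟩) := tendsto_subtype_rng.2 htend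
    exact hc.mem_of_tendsto htend' (Filter.Eventually.of_forall fun n => ⟨_, rfl⟩)
  obtain ⟨a, ha⟩ := hmem
  simp only at ha
  -- Closedness puts the limit `s` of the first half into the set, and the only element available is
  -- the first one of the second half, `y 0`.
  rcases lt_or_eq_of_le hsy with hlt | heq
  · exfalso
    induction a using Lex.rec with | _ a =>
    rcases a with n | n
    · have : x (n + 1) ≤ s := hlub.1 ⟨_, rfl⟩
      have h2 : x n < x (n + 1) := hxm (Nat.lt_succ_self n)
      exact absurd (h2.trans_le this) (by rw [← ha]; exact lt_irrefl _)
    · have : y 0 ≤ y n := hym.monotone (Nat.zero_le n)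
      exact absurd (hlt.trans_le this) (by rw [← ha]; exact lt_irrefl _)
  · refine ⟨x, s, fun n => y (n + 1), hxm, hlub, fun a b hab => hym (Nat.succ_lt_succ hab),
      fun n => ?_, fun n => ⟨_, rfl⟩, ⟨a, ha⟩, fun n => ⟨_, rfl⟩⟩
    rw [heq]
    exact hym (Nat.succ_pos n)

/-- Closedness holds because `p` is the only accumulation point below the supremum: `y` accumulates
only at the supremum itself, which the definition ignores. -/
theorem exists_closedInSup_of_sequences {x y : ℕ → Ordinal.{u}} {p : Ordinal.{u}}
    (hx : StrictMono x) (hp : IsLUB (Set.range x) p) (hy : StrictMono y) (hpy : ∀ n, p < y n) :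
    HasOrderType (Set.range x ∪ {p} ∪ Set.range y) (ω * 2) ∧
      ClosedInSup (Set.range x ∪ {p} ∪ Set.range y) := by
  have hxp : ∀ n, x n < p := fun n => (hx (Nat.lt_succ_self n)).trans_le (hp.1 ⟨_, rfl⟩)
  set X := Set.range x ∪ {p} ∪ Set.range y with hX
  constructor
  · rw [hasOrderType_omega0_mul_two_iff]
    refine ⟨fun a => Sum.elim x (fun n => Nat.casesOn n p y) (ofLex a), ?_, ?_⟩
    · intro a b hab
      induction a using Lex.rec with | _ a =>
      induction b using Lex.rec with | _ b =>
      rcases a with m | m <;> rcases b with n | n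
      · exact hx (Sum.Lex.inl_lt_inl_iff.1 hab)
      · rcases n with _ | n
        · exact hxp m
        · exact (hxp m).trans (hpy n)
      · exact absurd hab Sum.Lex.not_inr_lt_inl
      · have h := Sum.Lex.inr_lt_inr_iff.1 hab
        rcases m with _ | m <;> rcases n with _ | n
        · exact absurd h (lt_irrefl _)
        · exact hpy n
        · exact absurd h (Nat.not_lt_zero _)
        · exact hy (Nat.lt_of_succ_lt_succ h)
    · ext a
      constructor
      · rintro ⟨b, rfl⟩
        induction b using Lex.rec with | _ b =>
        rcases b with n | n
        · exact Or.inl (Or.inl ⟨n, rfl⟩)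
        · rcases n with _ | n
          · exact Or.inl (Or.inr rfl)
          · exact Or.inr ⟨n, rfl⟩
      · rintro ((⟨n, rfl⟩ | rfl) | ⟨n, rfl⟩)
        · exact ⟨toLex (Sum.inl n), rfl⟩
        · exact ⟨toLex (Sum.inr 0), rfl⟩
        · exact ⟨toLex (Sum.inr (n + 1)), rfl⟩
  · have hbX : BddAbove X := by
      have hb : ∀ g : ℕ → Ordinal.{u}, BddAbove (Set.range g) := fun g => Ordinal.bddAbove_of_small
      exact ((hb x).union (bddAbove_singleton)).union (hb y)
    have hXlub : IsLUB X (sSup X) := isLUB_csSup ⟨p, Or.inl (Or.inr rfl)⟩ hbX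
    unfold ClosedInSup
    rw [← isOpen_compl_iff, isOpen_iff_mem_nhds]
    rintro ⟨c, hc⟩ hcX
    have hcX' : c ∉ X := hcX
    -- a left neighbourhood `Ioi a` of `c` and a right neighbourhood `Iio b` missing `X`
    suffices ∃ b, c < b ∧ ((∀ d, d ≤ c → d ∉ X) ∨ ∃ a < c, ∀ d ∈ X, ¬ (a < d ∧ d < b)) ∧
        ∀ d ∈ X, ¬ (c < d ∧ d < b) by
      obtain ⟨b, hcb, h1, h2⟩ := this
      have hb : {d : Set.Iio (sSup X) | (d : Ordinal.{u}) < b} ∈ nhds (⟨c, hc⟩ : Set.Iio (sSup X)) :=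
        (isOpen_Iio.preimage continuous_subtype_val).mem_nhds hcb
      rcases h1 with h1 | ⟨a, hac, h1⟩
      · filter_upwards [hb] with d hd hdX
        rcases le_or_gt (d : Ordinal.{u}) c with h | h
        · exact h1 _ h hdX
        · exact h2 _ hdX ⟨h, hd⟩
      · have ha : {d : Set.Iio (sSup X) | a < (d : Ordinal.{u})} ∈
            nhds (⟨c, hc⟩ : Set.Iio (sSup X)) :=
          (isOpen_Ioi.preimage continuous_subtype_val).mem_nhds hac
        filter_upwards [hb, ha] with d hd hda hdX
        exact h1 _ hdX ⟨hda, hd⟩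
    have hcp : c ≠ p := fun h => hcX' (h ▸ Or.inl (Or.inr rfl))
    have hcx : ∀ n, c ≠ x n := fun n h => hcX' (h ▸ Or.inl (Or.inl ⟨n, rfl⟩))
    have hcy : ∀ n, c ≠ y n := fun n h => hcX' (h ▸ Or.inr ⟨n, rfl⟩)
    -- the least element of `X` above `c`, and the finitely many elements below
    have step : ∀ (g : ℕ → Ordinal.{u}), StrictMono g → (∀ n, c ≠ g n) → (∃ n, c < g n) →
        (∃ n, c < g n ∧ ((∀ m, c < g m) ∨ ∃ k, g k < c ∧ ∀ m, g m ≤ g k ∨ g n ≤ g m) ∧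
          ∀ m, g m < c ∨ g n ≤ g m) := by
      intro g hg hne hex
      classical
      refine ⟨Nat.find hex, Nat.find_spec hex, ?_, ?_⟩
      · rcases Nat.eq_zero_or_pos (Nat.find hex) with h0 | h0
        · left
          intro m
          have h1 := Nat.find_spec hex
          rw [h0] at h1
          exact h1.trans_le (hg.monotone (Nat.zero_le m))
        · right
          refine ⟨Nat.find hex - 1, ?_, fun m => ?_⟩
          · have := Nat.find_min hex (m := Nat.find hex - 1) (by omega)
            exact lt_of_le_of_ne (not_lt.1 this) (hne _).symm
          · rcases Nat.lt_or_ge m (Nat.find hex) with h | h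
            · exact Or.inl (hg.monotone (by omega))
            · exact Or.inr (hg.monotone h)
      · intro m
        rcases Nat.lt_or_ge m (Nat.find hex) with h | h
        · exact Or.inl (lt_of_le_of_ne (not_lt.1 (Nat.find_min hex h)) (hne _).symm)
        · exact Or.inr (hg.monotone h)
    rcases lt_or_gt_of_ne hcp with hlt | hgt
    · have hex : ∃ n, c < x n := by
        obtain ⟨_, ⟨n, rfl⟩, h, -⟩ := hp.exists_between hlt
        exact ⟨n, h⟩
      obtain ⟨n, hn, h1, h2⟩ := step x hx hcx hex
      refine ⟨x n, hn, ?_, ?_⟩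
      · rcases h1 with h1 | ⟨k, hk, h1⟩
        · left
          rintro d hd ((⟨m, rfl⟩ | rfl) | ⟨m, rfl⟩)
          · exact absurd (h1 m) (not_lt.2 hd)
          · exact absurd hlt (not_lt.2 hd)
          · exact absurd (hlt.trans (hpy m)) (not_lt.2 hd)
        · right
          refine ⟨x k, hk, ?_⟩
          rintro d ((⟨m, rfl⟩ | rfl) | ⟨m, rfl⟩) ⟨ha, hb⟩
          · rcases h1 m with h | h
            · exact absurd ha (not_lt.2 h)
            · exact absurd hb (not_lt.2 h)
          · exact absurd hb (hxp n).not_gt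
          · exact absurd hb ((hxp n).trans (hpy m)).not_gt
      · rintro d ((⟨m, rfl⟩ | rfl) | ⟨m, rfl⟩) ⟨ha, hb⟩
        · rcases h2 m with h | h
          · exact absurd ha h.not_gt
          · exact absurd hb (not_lt.2 h)
        · exact absurd hb (hxp n).not_gt
        · exact absurd hb ((hxp n).trans (hpy m)).not_gt
    · have hex : ∃ n, c < y n := by
        obtain ⟨_, (⟨n, rfl⟩ | rfl) | ⟨n, rfl⟩, h, -⟩ := hXlub.exists_between hc
        · exact absurd (h.trans (hxp n)) hgt.not_gt
        · exact absurd h hgt.not_gt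
        · exact ⟨n, h⟩
      obtain ⟨n, hn, h1, h2⟩ := step y hy hcy hex
      refine ⟨y n, hn, Or.inr ?_, ?_⟩
      · rcases h1 with h1 | ⟨k, hk, h1⟩
        · refine ⟨p, hgt, ?_⟩
          rintro d ((⟨m, rfl⟩ | rfl) | ⟨m, rfl⟩) ⟨ha, hb⟩
          · exact absurd ha (hxp m).not_gt
          · exact absurd ha (lt_irrefl _)
          · rcases h2 m with h | h
            · exact absurd (h1 m) h.not_gt
            · exact absurd hb (not_lt.2 h)
        · refine ⟨y k, hk, ?_⟩
          rintro d ((⟨m, rfl⟩ | rfl) | ⟨m, rfl⟩) ⟨ha, hb⟩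
          · exact absurd ha ((hxp m).trans (hpy k)).not_gt
          · exact absurd ha (hpy k).not_gt
          · rcases h1 m with h | h
            · exact absurd ha (not_lt.2 h)
            · exact absurd hb (not_lt.2 h)
      · rintro d ((⟨m, rfl⟩ | rfl) | ⟨m, rfl⟩) ⟨ha, hb⟩
        · exact absurd (ha.trans (hxp m)) hgt.not_gt
        · exact absurd ha hgt.not_gt
        · rcases h2 m with h | h
          · exact absurd ha h.not_gt
          · exact absurd hb (not_lt.2 h)

/-! ### Ordinals up to `ω ^ 3` as the nodes of a tree. -/

theorem lt_mul_omega0_iff {a b : Ordinal.{u}} : a < b * ω ↔ ∃ n : ℕ, a < b * n := by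
  rw [lt_mul_iff_of_isSuccLimit isSuccLimit_omega0]
  constructor
  · rintro ⟨c, hc, h⟩
    obtain ⟨n, rfl⟩ := lt_omega0.1 hc
    exact ⟨n, h⟩
  · rintro ⟨n, h⟩
    exact ⟨n, natCast_lt_omega0 n, h⟩

theorem lt_add_mul_omega0 {a b c : Ordinal.{u}} (h : a < c + b * ω) :
    ∃ n : ℕ, a < c + b * n := by
  rcases lt_or_ge a c with hac | hac
  · exact ⟨0, by simpa using hac⟩
  · obtain ⟨d, rfl⟩ := le_iff_exists_add.1 hac
    obtain ⟨n, hn⟩ := lt_mul_omega0_iff.1 (lt_of_add_lt_add_left h)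
    exact ⟨n, by gcongr⟩

/-- The points of `ω ^ 3 + 1` in a tree-like parametrization: `nodeVal [b, k, j]` is isolated, and
`nodeVal l` is the limit of the values of the extensions of `l`, for shorter `l`. -/
noncomputable def nodeVal : List ℕ → Ordinal.{u}
  | [] => ω ^ 3
  | [b] => ω ^ 2 * (b + 1)
  | [b, k] => ω ^ 2 * b + ω * (k + 1)
  | [b, k, j] => ω ^ 2 * b + ω * k + (j + 1)
  | _ => 0

theorem omega0_mul_natCast_lt_sq (k : ℕ) : (ω : Ordinal.{u}) * k < ω ^ 2 := by
  rw [pow_two]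
  exact (mul_lt_mul_iff_right₀ omega0_pos).2 (natCast_lt_omega0 k)

theorem omega0_sq_pos : (0 : Ordinal.{u}) < ω ^ 2 := by
  rw [pow_two]
  exact mul_pos omega0_pos omega0_pos

theorem sq_mul_natCast_lt_cube (k : ℕ) : (ω : Ordinal.{u}) ^ 2 * k < ω ^ 3 := by
  rw [pow_succ ω 2]
  exact (mul_lt_mul_iff_right₀ omega0_sq_pos).2 (natCast_lt_omega0 k)

theorem nodeVal_third_le (b k j : ℕ) :
    (nodeVal [b, k, j] : Ordinal.{u}) < ω ^ 2 * b + ω * (k + 1) := by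
  rw [nodeVal, add_assoc, mul_add_one]
  gcongr
  exact_mod_cast natCast_lt_omega0 (j + 1)

theorem lt_nodeVal_third (b k j : ℕ) :
    ω ^ 2 * b + ω * k < (nodeVal [b, k, j] : Ordinal.{u}) := by
  rw [nodeVal]
  exact lt_add_of_pos_right _ (by exact_mod_cast Nat.succ_pos j)

theorem nodeVal_second_lt (b k : ℕ) (l : List ℕ) :
    (nodeVal (b :: k :: l) : Ordinal.{u}) < ω ^ 2 * (b + 1) := by
  have h : (ω : Ordinal.{u}) ^ 2 * b + ω * (k + 1) < ω ^ 2 * (b + 1) := by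
    rw [mul_add_one (ω ^ 2)]
    have := omega0_mul_natCast_lt_sq.{u} (k + 1)
    rw [Nat.cast_succ] at this
    exact (add_lt_add_iff_left _).2 this
  match l with
  | [] => exact h
  | [j] => exact (nodeVal_third_le b k j).trans h
  | _ :: _ :: _ => exact lt_of_le_of_lt (by simp [nodeVal]) h

theorem lt_nodeVal_first {b : ℕ} {l : List ℕ} (hl : l.length ≤ 2) :
    ω ^ 2 * b < (nodeVal (b :: l) : Ordinal.{u}) := by
  match l, hl with
  | [], _ =>
    rw [nodeVal]
    exact (mul_lt_mul_iff_right₀ omega0_sq_pos).2 (by exact_mod_cast Nat.lt_succ_self b)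
  | [k], _ =>
    rw [nodeVal]
    exact lt_add_of_pos_right _ (mul_pos omega0_pos (by exact_mod_cast Nat.succ_pos k))
  | [k, j], _ => exact lt_of_le_of_lt (le_add_of_nonneg_right zero_le) (lt_nodeVal_third b k j)

theorem nodeVal_first_le (b : ℕ) (l : List ℕ) :
    (nodeVal (b :: l) : Ordinal.{u}) ≤ ω ^ 2 * (b + 1) := by
  match l with
  | [] => exact le_rfl
  | k :: l => exact (nodeVal_second_lt b k l).le

theorem nodeVal_cons_lt_cube (b : ℕ) (l : List ℕ) : (nodeVal (b :: l) : Ordinal.{u}) < ω ^ 3 :=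
  (nodeVal_first_le b l).trans_lt (by exact_mod_cast sq_mul_natCast_lt_cube (b + 1))

theorem nodeVal_le_cube (l : List ℕ) : (nodeVal l : Ordinal.{u}) ≤ ω ^ 3 := by
  match l with
  | [] => exact le_rfl
  | b :: l => exact (nodeVal_cons_lt_cube b l).le

theorem nodeVal_lt_of_first_lt {b b' : ℕ} (l : List ℕ) {l' : List ℕ} (hl : l'.length ≤ 2)
    (h : b < b') : (nodeVal (b :: l) : Ordinal.{u}) < nodeVal (b' :: l') := by
  refine (nodeVal_first_le b l).trans_lt (lt_of_le_of_lt ?_ (lt_nodeVal_first hl))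
  gcongr
  exact_mod_cast h

theorem nodeVal_lt_of_second_lt {b k k' : ℕ} {l l' : List ℕ} (hl : l.length ≤ 1)
    (hl' : l'.length ≤ 1) (h : k < k') :
    (nodeVal (b :: k :: l) : Ordinal.{u}) < nodeVal (b :: k' :: l') := by
  have h1 : (nodeVal (b :: k :: l) : Ordinal.{u}) ≤ ω ^ 2 * b + ω * (k + 1) := by
    match l, hl with
    | [], _ => exact le_rfl
    | [j], _ => exact (nodeVal_third_le b k j).le
  have h2 : ω ^ 2 * b + ω * k' < (nodeVal (b :: k' :: l') : Ordinal.{u}) := by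
    match l', hl' with
    | [], _ =>
      rw [nodeVal]
      gcongr
      · exact omega0_pos
      · exact_mod_cast Nat.lt_succ_self k'
    | [j], _ => exact lt_nodeVal_third b k' j
  refine h1.trans_lt (lt_of_le_of_lt ?_ h2)
  gcongr
  exact_mod_cast h

theorem nodeVal_lt_of_third_lt {b k j j' : ℕ} (h : j < j') :
    (nodeVal [b, k, j] : Ordinal.{u}) < nodeVal [b, k, j'] := by
  rw [nodeVal, nodeVal]
  refine (add_lt_add_iff_left _).2 ?_
  exact_mod_cast Nat.succ_lt_succ h

theorem nodeVal_append_lt_append {s l l' : List ℕ} {a a' : ℕ} (h : a < a')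
    (hl : s.length + l.length ≤ 2) (hl' : s.length + l'.length ≤ 2) :
    (nodeVal (s ++ a :: l) : Ordinal.{u}) < nodeVal (s ++ a' :: l') := by
  match s with
  | [] => exact nodeVal_lt_of_first_lt l (by simpa using hl') h
  | [b] =>
    exact nodeVal_lt_of_second_lt (by simp at hl; omega) (by simp at hl'; omega) h
  | [b, k] =>
    have h1 : l = [] := by simpa using hl
    have h2 : l' = [] := by simpa using hl'
    subst h1 h2
    exact nodeVal_lt_of_third_lt h
  | _ :: _ :: _ :: s => simp at hl; omega

theorem nodeVal_append_lt {s l : List ℕ} {a : ℕ} (hl : s.length + l.length ≤ 2) :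
    (nodeVal (s ++ a :: l) : Ordinal.{u}) < nodeVal s := by
  match s with
  | [] => exact nodeVal_cons_lt_cube a l
  | [b] => exact nodeVal_second_lt b a l
  | [b, k] =>
    have h1 : l = [] := by simpa using hl
    subst h1
    exact nodeVal_third_le b k a
  | _ :: _ :: _ :: s => simp at hl; omega

theorem exists_lt_nodeVal_append {s : List ℕ} (hs : s.length ≤ 2) {c : Ordinal.{u}}
    (hc : c < nodeVal s) :
    ∃ n : ℕ, ∀ a l, n ≤ a → s.length + l.length ≤ 2 → c < nodeVal (s ++ a :: l) := by
  match s, hs with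
  | [], _ =>
    rw [nodeVal, pow_succ ω 2, lt_mul_omega0_iff] at hc
    obtain ⟨n, hn⟩ := hc
    refine ⟨n, fun a l ha hl => hn.trans (lt_of_le_of_lt ?_ (lt_nodeVal_first (b := a) (by simpa using hl)))⟩
    gcongr
  | [b], _ =>
    rw [nodeVal, mul_add_one, pow_two ω] at hc
    obtain ⟨n, hn⟩ := lt_add_mul_omega0 hc
    rw [← pow_two] at hn
    refine ⟨n, fun a l ha hl => hn.trans_le ?_⟩
    have h2 : ω ^ 2 * b + ω * n ≤ (ω ^ 2 * b + ω * a : Ordinal.{u}) := by gcongr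
    refine h2.trans ?_
    match l, hl with
    | [], _ =>
      simp only [List.cons_append, List.nil_append, nodeVal]
      gcongr
      exact_mod_cast Nat.le_succ a
    | [j], _ => exact (lt_nodeVal_third b a j).le
    | _ :: _ :: l, hl => simp at hl; omega
  | [b, k], _ =>
    rw [nodeVal, mul_add_one, ← add_assoc, ← one_mul ω, mul_assoc, one_mul (ω * _)] at hc
    obtain ⟨n, hn⟩ := lt_add_mul_omega0 hc
    refine ⟨n, fun a l ha hl => hn.trans_le ?_⟩
    have h1 : l = [] := by simpa using hl
    subst h1
    simp only [List.cons_append, List.nil_append, nodeVal, one_mul]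
    gcongr
    exact_mod_cast (by omega : n ≤ a + 1)

/-- Only the label right after `s` has to grow; the tails `l n` are free. Hence a node is a limit of
its descendants of any fixed greater length, which is what the upper bound exploits. -/
theorem isLUB_nodeVal_append {s : List ℕ} {f : ℕ → ℕ} {l : ℕ → List ℕ} (hf : StrictMono f)
    (hl : ∀ n, s.length + (l n).length ≤ 2) :
    IsLUB (Set.range fun n => (nodeVal (s ++ f n :: l n) : Ordinal.{u})) (nodeVal s) := by
  constructor
  · rintro _ ⟨n, rfl⟩
    exact (nodeVal_append_lt (hl n)).le
  · intro c hc
    by_contra! h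
    obtain ⟨n, hn⟩ := exists_lt_nodeVal_append (by have := hl 0; omega) h
    exact absurd (hc ⟨n, rfl⟩) (not_le.2 (hn _ _ (hf.id_le n) (hl n)))

/-- Every ordinal strictly between `0` and `ω ^ 3` is the value of a node. -/
theorem exists_nodeVal_eq {a : Ordinal.{u}} (h0 : a ≠ 0) (h : a < ω ^ 3) :
    (∃ b k j, a = nodeVal [b, k, j]) ∨ (∃ b k, a = nodeVal [b, k]) ∨ ∃ b, a = nodeVal [b] := by
  have hω : (ω : Ordinal.{u}) ≠ 0 := omega0_ne_zero
  have hω2 : (ω ^ 2 : Ordinal.{u}) ≠ 0 := omega0_sq_pos.ne'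
  obtain ⟨b, hb⟩ : ∃ b : ℕ, a / ω ^ 2 = b := by
    apply lt_omega0.1
    rw [← lt_mul_iff_div_lt hω2, ← pow_succ]
    exact h
  obtain ⟨k, hk⟩ : ∃ k : ℕ, a % ω ^ 2 / ω = k := by
    apply lt_omega0.1
    rw [← lt_mul_iff_div_lt hω, ← pow_two]
    exact mod_lt a hω2
  obtain ⟨j, hj⟩ : ∃ j : ℕ, a % ω ^ 2 % ω = j := lt_omega0.1 (mod_lt _ hω)
  have ha : a = ω ^ 2 * b + (ω * k + j) := by
    rw [← hb, ← hk, ← hj, div_add_mod, div_add_mod]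
  -- The last nonzero coefficient of the Cantor normal form decides the length of the word; its
  -- label is that coefficient minus one.
  rcases j with _ | j
  · rcases k with _ | k
    · rcases b with _ | b
      · simp at ha
        exact absurd ha h0
      · right; right
        exact ⟨b, by simpa [nodeVal] using ha⟩
    · right; left
      exact ⟨b, k, by simpa [nodeVal] using ha⟩
  · left
    exact ⟨b, k, j, by simpa [nodeVal, add_assoc] using ha⟩

/-! ### Ramsey's theorem and canonical labels. -/

theorem Ultrafilter.exists_eventually_eq {κ : Type*} [Finite κ] (U : Ultrafilter ℕ) (g : ℕ → κ) :
    ∃ c, ∀ᶠ n in U, g n = c := by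
  have h : ∀ᶠ n in U, g n ∈ (Set.univ : Set κ) := Filter.Eventually.of_forall fun n => trivial
  have h2 : (⋃ c ∈ (Set.univ : Set κ), {n | g n = c}) ∈ U := by
    filter_upwards [h] with n hn
    simp
  obtain ⟨c, -, hc⟩ := (Ultrafilter.finite_biUnion_mem_iff Set.finite_univ).1 h2
  exact ⟨c, hc⟩

/-- Ramsey's theorem for finitely many colours and subsets of `ℕ` of size `r`. -/
theorem exists_strictMono_forall_card_eq {κ : Type*} [Finite κ] (r : ℕ) (f : Finset ℕ → κ) :
    ∃ h : ℕ → ℕ, StrictMono h ∧ ∃ c, ∀ s : Finset ℕ, s.card = r → f (s.image h) = c := by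
  classical
  let U : Ultrafilter ℕ := Filter.hyperfilter ℕ
  choose lim hlim using fun g : ℕ → κ => U.exists_eventually_eq g
  -- `F k s` is the iterated limit of `f`, along the ultrafilter, over `k` further elements inserted
  -- into `s`. The sequence `h` is chosen greedily so that each new term already realizes these
  -- limits over all earlier sets.
  let F : ℕ → Finset ℕ → κ := fun k => Nat.rec f (fun _ G s => lim fun n => G (insert n s)) k
  have hF : ∀ k s, ∀ᶠ n in U, F k (insert n s) = F (k + 1) s := fun k s => hlim _
  have hnext : ∀ A : Finset ℕ, ∃ n, (∀ a ∈ A, a < n) ∧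
      ∀ k ∈ Finset.range r, ∀ s ∈ A.powerset, F k (insert n s) = F (k + 1) s := by
    intro A
    have h1 : ∀ᶠ n in U, ∀ a ∈ A, a < n := by
      rw [Filter.eventually_all_finset]
      intro a _
      exact Nat.hyperfilter_le_atTop (Filter.eventually_gt_atTop a)
    have h2 : ∀ᶠ n in U, ∀ k ∈ Finset.range r, ∀ s ∈ A.powerset,
        F k (insert n s) = F (k + 1) s := by
      rw [Filter.eventually_all_finset]
      intro k _
      rw [Filter.eventually_all_finset]
      intro s _
      exact hF k s
    exact (h1.and h2).exists
  choose next hlt heq using hnext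
  let A : ℕ → Finset ℕ := fun n => Nat.rec ∅ (fun _ B => insert (next B) B) n
  let h : ℕ → ℕ := fun n => next (A n)
  have hA : ∀ m n, m < n → h m ∈ A n := by
    intro m n hmn
    induction n, hmn using Nat.le_induction with
    | base => exact Finset.mem_insert_self _ _
    | succ n _ ih => exact Finset.mem_insert_of_mem ih
  have hmono : StrictMono h := fun m n hmn => hlt _ _ (hA m n hmn)
  refine ⟨h, hmono, F r ∅, fun s hs => ?_⟩
  -- Elements are removed from the largest downwards, each removal costing one limit.
  have key : ∀ s : Finset ℕ, ∀ k, k + s.card ≤ r → F k (s.image h) = F (k + s.card) ∅ := by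
    intro s
    induction s using Finset.induction_on_max with
    | empty => simp
    | insert m s hm ih =>
      intro k hk
      have hms : m ∉ s := fun h => lt_irrefl _ (hm m h)
      rw [Finset.card_insert_of_notMem hms] at hk ⊢
      rw [Finset.image_insert, heq (A m) k (Finset.mem_range.2 (by omega)) _ ?_, ih (k + 1) (by omega)]
      · rw [show k + 1 + s.card = k + (s.card + 1) by omega]
      · rw [Finset.mem_powerset]
        intro a ha
        obtain ⟨b, hb, rfl⟩ := Finset.mem_image.1 ha
        exact hA b m (hm b hb)
  have := key s 0 (by omega)
  rw [zero_add, hs] at this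
  exact this

/-- The points of `ω ^ 3 * 2` other than `0`: the tree of `nodeVal` below `ω ^ 3` and a copy of it
above `ω ^ 3`. -/
noncomputable def point (t : Bool) (l : List ℕ) : Ordinal.{u} :=
  (bif t then ω ^ 3 else 0) + nodeVal l

theorem finite_setOf_length_le_and_lt (k N : ℕ) :
    {l : List ℕ | l.length ≤ k ∧ ∀ a ∈ l, a < N}.Finite := by
  refine ((List.finite_length_le (Fin N) k).image (List.map Fin.val)).subset ?_
  rintro l ⟨hl, ha⟩
  exact ⟨l.pmap Fin.mk ha, by simpa using hl, by simp [List.map_pmap]⟩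

/-- A relation between lists of natural numbers of bounded length can be made, by thinning out the
labels, to depend only on the interleaving of the labels. -/
theorem exists_strictMono_forall_map_iff (N k : ℕ) (G : Bool → List ℕ → Bool → List ℕ → Prop) :
    ∃ h : ℕ → ℕ, StrictMono h ∧ ∀ (t t' : Bool) (I J : List ℕ) (f g : ℕ → ℕ),
      I.length ≤ k → J.length ≤ k → (∀ a ∈ I, a < N) → (∀ a ∈ J, a < N) →
      (∀ j < N, ∀ i < j, f i < f j) → (∀ j < N, ∀ i < j, g i < g j) →
      (G t ((I.map f).map h) t' ((J.map f).map h) ↔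
        G t ((I.map g).map h) t' ((J.map g).map h)) := by
  classical
  let S : Set (List ℕ) := {l : List ℕ | l.length ≤ k ∧ ∀ a ∈ l, a < N}
  have : Finite S := finite_setOf_length_le_and_lt k N
  let e : Finset ℕ → ℕ → ℕ := fun T i =>
    if hT : T.card = N then (if hi : i < N then T.orderEmbOfFin hT ⟨i, hi⟩ else 0) else 0
  -- The colour of an `N`-set `T` is the whole relation induced by `G` on short words over `N`
  -- letters, read through the enumeration `e T`. There are finitely many such relations because `S`
  -- is finite.
  obtain ⟨h, hmono, c, hc⟩ := exists_strictMono_forall_card_eq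
    (κ := Bool → S → Bool → S → Prop) N
    (fun T t I t' J => G t ((I : List ℕ).map (e T)) t' ((J : List ℕ).map (e T)))
  refine ⟨h, hmono, ?_⟩
  have key : ∀ (t t' : Bool) (I J : List ℕ) (hI : I ∈ S) (hJ : J ∈ S) (f : ℕ → ℕ),
      (∀ j < N, ∀ i < j, f i < f j) →
      (G t ((I.map f).map h) t' ((J.map f).map h) ↔ c t ⟨I, hI⟩ t' ⟨J, hJ⟩) := by
    intro t t' I J hI hJ f hf
    have hinj : Set.InjOn f (Finset.range N : Finset ℕ) := by
      intro a ha b hb hab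
      simp only [Finset.coe_range, Set.mem_Iio] at ha hb
      rcases lt_trichotomy a b with h | h | h
      · exact absurd hab (hf b hb a h).ne
      · exact h
      · exact absurd hab (hf a ha b h).ne'
    have hs : ((Finset.range N).image f).card = N := by
      rw [Finset.card_image_of_injOn hinj, Finset.card_range]
    have hT : (((Finset.range N).image f).image h).card = N := by
      rw [Finset.card_image_of_injective _ hmono.injective, hs]
    have he : ∀ i < N, h (f i) = e (((Finset.range N).image f).image h) i := by
      intro i hi
      have hu := Finset.orderEmbOfFin_unique hT (f := fun i : Fin N => h (f i))
        (fun x => Finset.mem_image_of_mem _ (Finset.mem_image_of_mem _ (Finset.mem_range.2 x.2)))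
        (fun a b hab => hmono (hf b b.2 a hab))
      simp only [e, dif_pos hT, dif_pos hi]
      exact congrFun hu ⟨i, hi⟩
    have h1 := congrFun (congrFun (congrFun (congrFun (hc _ hs) t) ⟨I, hI⟩) t') ⟨J, hJ⟩
    rw [← h1]
    simp only [List.map_map]
    have hI' : I.map (h ∘ f) = I.map (e (((Finset.range N).image f).image h)) :=
      List.map_congr_left fun a ha => he a (hI.2 a ha)
    have hJ' : J.map (h ∘ f) = J.map (e (((Finset.range N).image f).image h)) :=
      List.map_congr_left fun a ha => he a (hJ.2 a ha)
    rw [hI', hJ']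
  intro t t' I J f g hI hJ hI' hJ' hf hg
  rw [key t t' I J ⟨hI, hI'⟩ ⟨hJ, hJ'⟩ f hf, key t t' I J ⟨hI, hI'⟩ ⟨hJ, hJ'⟩ g hg]

/-! ### Canonical graphs and changes of labels. -/

/-- `(t, s)` precedes all nodes extending `(t', s')` by large labels. -/
def Precedes (t : Bool) (s : List ℕ) (t' : Bool) (s' : List ℕ) : Prop :=
  (t = false ∧ t' = true) ∨ (t = t' ∧ ∃ b l, s = b :: l ∧
    (s' = [] ∨ (∃ b' l', s' = b' :: l' ∧ b < b') ∨ (s' = [b] ∧ l ≠ [])))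

theorem precedes_of_ne : Precedes false s true s' := Or.inl ⟨rfl, rfl⟩

theorem precedes_nil {t b l} : Precedes t (b :: l) t [] := Or.inr ⟨rfl, b, l, rfl, Or.inl rfl⟩

theorem precedes_of_lt {t b b' l l'} (h : b < b') : Precedes t (b :: l) t (b' :: l') :=
  Or.inr ⟨rfl, b, l, rfl, Or.inr (Or.inl ⟨b', l', rfl, h⟩)⟩

theorem precedes_singleton {t b k l} : Precedes t (b :: k :: l) t [b] :=
  Or.inr ⟨rfl, b, k :: l, rfl, Or.inr (Or.inr ⟨rfl, by simp⟩)⟩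

/-- A triangle-free graph on the nodes of two trees such that adjacency depends only on the
interleaving of labels, and such that there are no independent sets consisting of a sequence of
nodes, its limit and a sequence of later nodes. -/
structure IsCanonicalGraph (E : Bool → List ℕ → Bool → List ℕ → Prop) : Prop where
  symm : ∀ {t I t' J}, E t I t' J → E t' J t I
  map_iff : ∀ (t t' : Bool) (I J : List ℕ) (f g : ℕ → ℕ),
      I.length ≤ 3 → J.length ≤ 3 → (∀ a ∈ I, a < 8) → (∀ a ∈ J, a < 8) →
      (∀ j < 8, ∀ i < j, f i < f j) → (∀ j < 8, ∀ i < j, g i < g j) →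
      (E t (I.map f) t' (J.map f) ↔ E t (I.map g) t' (J.map g))
  tri : ∀ {t t' t''} (I J K : List ℕ), E t I t' J → E t' J t'' K → E t I t'' K → False
  exists_edge : ∀ (t : Bool) (s : List ℕ) (d : ℕ) (t' : Bool) (s' : List ℕ) (d' c : ℕ),
    1 ≤ d → 1 ≤ d' → s.length + d ≤ 3 → s'.length + d' ≤ 3 → (∀ a ∈ s, a < c) →
    Precedes t s t' s' →
    (∃ a, c ≤ a ∧ E t s t (s ++ List.range' a d)) ∨
    (∃ a b, c ≤ a ∧ a + d ≤ b ∧ E t (s ++ List.range' a d) t (s ++ List.range' b d)) ∨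
    (∃ a, c ≤ a ∧ E t s t' (s' ++ List.range' a d')) ∨
    (∃ a b, c ≤ a ∧ a + d' ≤ b ∧ E t' (s' ++ List.range' a d') t' (s' ++ List.range' b d')) ∨
    (∃ a b, c ≤ a ∧ a + d ≤ b ∧ E t (s ++ List.range' a d) t' (s' ++ List.range' b d')) ∨
    (∃ a b, c ≤ b ∧ b + d' ≤ a ∧ E t (s ++ List.range' a d) t' (s' ++ List.range' b d'))

theorem map_range'_of_forall {f : ℕ → ℕ} {a b d : ℕ} (h : ∀ i < d, f (a + i) = b + i) :
    (List.range' a d).map f = List.range' b d := by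
  apply List.ext_getElem
  · simp
  · intro i h1 h2
    simp only [List.length_map, List.length_range'] at h1
    simp [h i h1]

theorem map_append_range'_of_forall {s : List ℕ} {f : ℕ → ℕ} {a b d : ℕ} (hs : ∀ x ∈ s, f x = x)
    (h : ∀ i < d, f (a + i) = b + i) :
    (s ++ List.range' a d).map f = s ++ List.range' b d := by
  rw [List.map_append, map_range'_of_forall h, List.map_congr_left (g := id) hs, List.map_id]

namespace IsCanonicalGraph

variable {E : Bool → List ℕ → Bool → List ℕ → Prop} (H : IsCanonicalGraph E)

/-- The labels in `l`, in increasing order. -/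
def sortedLabels (l : List ℕ) : List ℕ :=
  l.foldr (fun a m => if a ∈ m then m else m.orderedInsert (· ≤ ·) a) []

/-- The increasing enumeration of the labels in `l`, continued to an increasing function. -/
def enumLabels (l : List ℕ) (i : ℕ) : ℕ := (sortedLabels l).getD i (100 + i)

/-- The position of a label among the labels in `l`. -/
def labelRank (l : List ℕ) (a : ℕ) : ℕ := (sortedLabels l).countP (· < a)

include H

/-- Adjacency is preserved when the labels are changed without changing their interleaving. -/
theorem move {t t' : Bool} {I J I' J' : List ℕ} (h : E t I t' J)
    (hc : (I.length ≤ 3 ∧ J.length ≤ 3 ∧ (∀ a ∈ I.map (labelRank (I ++ J)), a < 8) ∧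
        ∀ a ∈ J.map (labelRank (I ++ J)), a < 8) ∧
      (∀ j < 8, ∀ i < j, enumLabels (I ++ J) i < enumLabels (I ++ J) j) ∧
      (∀ j < 8, ∀ i < j, enumLabels (I' ++ J') i < enumLabels (I' ++ J') j) ∧
      (I.map (labelRank (I ++ J))).map (enumLabels (I ++ J)) = I ∧
      (J.map (labelRank (I ++ J))).map (enumLabels (I ++ J)) = J ∧
      (I.map (labelRank (I ++ J))).map (enumLabels (I' ++ J')) = I' ∧
      (J.map (labelRank (I ++ J))).map (enumLabels (I' ++ J')) = J' := by decide +kernel) :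
    E t I' t' J' := by
  obtain ⟨⟨h1, h2, h3, h4⟩, h5, h6, h7, h8, h9, h10⟩ := hc
  -- The ranks form a common pair of words that the two enumerations turn into `I, J` and `I', J'`.
  -- The default `100 + i` in `enumLabels` keeps these enumerations increasing past the last label
  -- when all labels are below 100.
  have h11 := H.map_iff t t' _ _ _ _ (by simpa using h1) (by simpa using h2) h3 h4 h5 h6
  rw [h7, h8, h9, h10] at h11
  exact h11.1 h

/-- Sliding two disjoint blocks of labels down to `c` and `c + d` keeps their order and leaves them
above all labels of `s` and `s'`, so the interleaving is unchanged. -/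
theorem of_append_range' {t t' : Bool} {s s' : List ℕ} {c d d' a b : ℕ}
    (h : E t (s ++ List.range' a d) t' (s' ++ List.range' b d'))
    (hs : ∀ x ∈ s, x < c) (hs' : ∀ x ∈ s', x < c) (hd : s.length + d ≤ 3)
    (hd' : s'.length + d' ≤ 3) (hc : c + d + d' ≤ 8) (ha : c ≤ a) (hb : a + d ≤ b) :
    E t (s ++ List.range' c d) t' (s' ++ List.range' (c + d) d') := by
  let f : ℕ → ℕ := fun i => if i < c then i else if i < c + d then i - c + a else i - (c + d) + b
  have h1 := H.map_iff t t' (s ++ List.range' c d) (s' ++ List.range' (c + d) d') f id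
    (by simpa using hd) (by simpa using hd') (by grind) (by grind) (by grind) (by grind)
  rw [List.map_id, List.map_id] at h1
  rw [← h1, map_append_range'_of_forall (b := a) (by grind) (by grind),
    map_append_range'_of_forall (b := b) (by grind) (by grind)]
  exact h

/-- Three consecutive blocks are pairwise in the same position, so one such edge would produce a
triangle. -/
theorem not_append_range' {t : Bool} {s : List ℕ} {c d a b : ℕ} (hs : ∀ x ∈ s, x < c)
    (hd : s.length + d ≤ 3) (hc : c + 2 * d ≤ 8) (ha : c ≤ a) (hb : a + d ≤ b) :
    ¬ E t (s ++ List.range' a d) t (s ++ List.range' b d) := by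
  intro h
  have h0 := H.of_append_range' h hs hs hd hd (by omega) ha hb
  have key : ∀ a b, c ≤ a → a + d ≤ b →
      E t (s ++ List.range' a d) t (s ++ List.range' b d) := by
    intro a b ha hb
    let f : ℕ → ℕ := fun i =>
      if i < c then i else if i < c + d then i - c + a else i - (c + d) + b
    have h1 := H.map_iff t t (s ++ List.range' c d) (s ++ List.range' (c + d) d) f id
      (by simpa using hd) (by simpa using hd) (by grind) (by grind) (by grind) (by grind)
    rw [List.map_id, List.map_id, map_append_range'_of_forall (b := a) (by grind) (by grind),
      map_append_range'_of_forall (b := b) (by grind) (by grind)] at h1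
    exact h1.2 h0
  exact H.tri _ _ _ (key c (c + d) le_rfl le_rfl) (key (c + d) (c + d + d) (by omega) le_rfl)
    (key c (c + d + d) le_rfl (by omega))

/-- The limit node `s` of the extensions of `s`, these extensions, and the extensions of a later
node `s'` are not independent. -/
theorem edge_cases (t : Bool) (s : List ℕ) (d : ℕ) (t' : Bool) (s' : List ℕ) (d' c : ℕ)
    (hp : Precedes t s t' s')
    (hc : (1 ≤ d ∧ 1 ≤ d' ∧ s.length + d ≤ 3 ∧ s'.length + d' ≤ 3) ∧ (∀ x ∈ s, x < c) ∧
      (∀ x ∈ s', x < c) ∧ c + 2 * d ≤ 8 ∧ c + 2 * d' ≤ 8 := by decide +kernel) :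
    E t s t (s ++ List.range' c d) ∨ E t s t' (s' ++ List.range' c d') ∨
      E t (s ++ List.range' c d) t' (s' ++ List.range' (c + d) d') ∨
      E t (s ++ List.range' (c + d') d) t' (s' ++ List.range' c d') := by
  obtain ⟨⟨h1, h2, h3, h4⟩, h5, h6, h7, h8⟩ := hc
  have hs : ∀ {t' s' a d'}, 1 ≤ d' → (∀ x ∈ s', x < c) → s'.length + d' ≤ 3 → c + 2 * d' ≤ 8 → c ≤ a →
      E t s t' (s' ++ List.range' a d') → E t s t' (s' ++ List.range' c d') := by
    intro t' s' a d' h1' h2 h3 h4 ha h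
    -- With an empty first block, only the block after `s'` slides.
    have := H.of_append_range' (d := 0) (a := c) (by simpa using h) h5 h2 (by omega) h3 (by omega)
      le_rfl (by simpa using ha)
    simpa using this
  rcases H.exists_edge t s d t' s' d' c h1 h2 h3 h4 h5 hp with
    ⟨a, ha, h⟩ | ⟨a, b, ha, hb, h⟩ | ⟨a, ha, h⟩ | ⟨a, b, ha, hb, h⟩ | ⟨a, b, ha, hb, h⟩ |
      ⟨a, b, ha, hb, h⟩
  · exact Or.inl (hs h1 h5 h3 h7 ha h)
  · exact absurd h (H.not_append_range' h5 h3 h7 ha hb)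
  · exact Or.inr (Or.inl (hs h2 h6 h4 h8 ha h))
  · exact absurd h (H.not_append_range' h6 h4 h8 ha hb)
  · exact Or.inr (Or.inr (Or.inl (H.of_append_range' h h5 h6 h3 h4 (by omega) ha hb)))
  · exact Or.inr (Or.inr (Or.inr
      (H.symm (H.of_append_range' (H.symm h) h6 h5 h4 h3 (by omega) ha hb))))

end IsCanonicalGraph

/-! ### Edges forced and forbidden within one tree. -/

namespace IsCanonicalGraph

variable {E : Bool → List ℕ → Bool → List ℕ → Prop} (H : IsCanonicalGraph E)

include H

/-- Here and in the next lemmas, three nodes pairwise interleaved in the given pattern would form a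
triangle. -/
theorem not_edge_one_one (t : Bool) : ¬ E t [0] t [1] := fun h =>
  H.tri [0] [1] [2] (H.move h) (H.move h) (H.move h)

theorem not_edge_two_two_separated (t : Bool) : ¬ E t [0, 1] t [2, 3] := fun h =>
  H.tri [0, 1] [2, 3] [4, 5] (H.move h) (H.move h) (H.move h)

theorem not_edge_two_two_nested (t : Bool) : ¬ E t [0, 3] t [1, 2] := fun h =>
  H.tri [0, 5] [1, 4] [2, 3] (H.move h) (H.move h) (H.move h)

theorem not_edge_three_three_separated (t : Bool) : ¬ E t [0, 1, 2] t [3, 4, 5] := fun h =>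
  H.tri [0, 1, 2] [3, 4, 5] [6, 7, 8] (H.move h) (H.move h) (H.move h)

theorem not_edge_three_three_nested (t : Bool) : ¬ E t [0, 4, 5] t [1, 2, 3] := fun h =>
  H.tri [0, 7, 8] [1, 5, 6] [2, 3, 4] (H.move h) (H.move h) (H.move h)

theorem not_edge_three_three_surrounded (t : Bool) : ¬ E t [0, 1, 5] t [2, 3, 4] := fun h =>
  H.tri [0, 1, 8] [2, 3, 7] [4, 5, 6] (H.move h) (H.move h) (H.move h)

theorem not_edge_three_three_crossing (t : Bool) : ¬ E t [0, 2, 3] t [1, 4, 5] := fun h =>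
  H.tri [0, 3, 4] [1, 5, 6] [2, 7, 8] (H.move h) (H.move h) (H.move h)

theorem not_edge_three_three_crossing' (t : Bool) : ¬ E t [0, 2, 5] t [1, 3, 4] := fun h =>
  H.tri [0, 3, 8] [1, 4, 7] [2, 5, 6] (H.move h) (H.move h) (H.move h)

theorem not_edge_three_three_common (t : Bool) : ¬ E t [0, 1, 2] t [0, 3, 4] := fun h =>
  H.tri [0, 1, 2] [0, 3, 4] [0, 5, 6] (H.move h) (H.move h) (H.move h)

theorem not_edge_three_three_common' (t : Bool) : ¬ E t [0, 1, 4] t [0, 2, 3] := fun h =>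
  H.tri [0, 1, 6] [0, 2, 5] [0, 3, 4] (H.move h) (H.move h) (H.move h)

/-- Otherwise nodes of length two would see later leaves in the three patterns `i1`, `i2`, `i3`.
Then `[0]` sees either its own or later leaves, and every edge that `edge_cases` allows among `[0]`,
its children and later nodes of length one closes to a triangle at a leaf. -/
theorem edge_two_three_child (t : Bool) : E t [0, 1] t [0, 1, 2] := by
  by_contra hI
  have i1 : E t [0, 1] t [2, 3, 4] := by
    rcases H.edge_cases t [0, 1] 1 t [] 3 2 precedes_nil with h | h | h | h
    · exact absurd h hI
    · exact h
    · exact absurd h (H.not_edge_three_three_separated t)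
    · exact absurd h (H.not_edge_three_three_surrounded t)
  have i2 : E t [0, 2] t [1, 3, 4] := by
    rcases H.edge_cases t [0, 2] 1 t [1] 2 3 (precedes_of_lt Nat.zero_lt_one) with h | h | h | h
    · exact absurd (H.move h) hI
    · exact h
    · exact absurd (H.move h) (H.not_edge_three_three_crossing t)
    · exact absurd (H.move h) (H.not_edge_three_three_crossing' t)
  have i3 : E t [0, 1] t [0, 2, 3] := by
    rcases H.edge_cases t [0, 1] 1 t [0] 2 2 precedes_singleton with h | h | h | h
    · exact absurd h hI
    · exact h
    · exact absurd h (H.not_edge_three_three_common t)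
    · exact absurd h (H.not_edge_three_three_common' t)
  by_cases hz : E t [0] t [0, 1, 2]
  · rcases H.edge_cases t [0] 1 t [] 1 1 precedes_nil with h | h | h | h
    · exact H.tri [0] [0, 1] [0, 2, 3] h i3 (H.move hz)
    · exact H.not_edge_one_one t h
    · exact H.tri [0, 1] [2] [2, 3, 4] h (H.move hz) i1
    · exact H.tri [0, 2] [1] [1, 3, 4] h (H.move hz) i2
  · have i4 : E t [0] t [1, 2, 3] := by
      rcases H.edge_cases t [0] 2 t [] 3 1 precedes_nil with h | h | h | h
      · exact absurd h hz
      · exact h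
      · exact absurd (H.move h) (H.not_edge_three_three_separated t)
      · exact absurd (H.move h) (H.not_edge_three_three_nested t)
    rcases H.edge_cases t [0] 1 t [] 1 1 precedes_nil with h | h | h | h
    · exact H.tri [0] [0, 1] [2, 3, 4] h i1 (H.move i4)
    · exact H.not_edge_one_one t h
    · exact H.tri [0, 1] [2] [3, 4, 5] h (H.move i4) (H.move i1)
    · exact H.tri [0, 2] [1] [3, 4, 5] h (H.move i4) (H.move i1)

/-- The case in which the nodes of length one are adjacent to the later nodes of length two. -/
theorem edges_of_edge_one_two {t : Bool} (h12 : E t [0] t [1, 2]) :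
    E t [0] t [0, 1, 2] ∧ E t [0, 1] t [2] ∧ E t [0, 4] t [1, 2, 3] := by
  have hown := H.edge_two_three_child t
  have hl : ¬ E t [0] t [1, 2, 3] := fun h => H.tri [0] [1, 2] [1, 2, 3] h12 (H.move hown) h
  have hz : E t [0] t [0, 1, 2] := by
    rcases H.edge_cases t [0] 2 t [] 3 1 precedes_nil with h | h | h | h
    · exact h
    · exact absurd h hl
    · exact absurd (H.move h) (H.not_edge_three_three_separated t)
    · exact absurd (H.move h) (H.not_edge_three_three_nested t)
  have hw : ¬ E t [0] t [0, 1] := fun h => H.tri [0] [0, 1] [0, 1, 2] h hown hz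
  have h21 : E t [0, 1] t [2] := by
    rcases H.edge_cases t [0] 1 t [] 1 1 precedes_nil with h | h | h | h
    · exact absurd h hw
    · exact absurd h (H.not_edge_one_one t)
    · exact h
    · exfalso
      -- The pattern `[0, 2]`, `[1]` is excluded by testing `[0]` and its children against the
      -- leaves below `[1]`.
      rcases H.edge_cases t [0] 1 t [1] 2 2 (precedes_of_lt Nat.zero_lt_one) with k | k | k | k
      · exact hw (H.move k)
      · exact hl (H.move k)
      · exact H.tri [0, 2] [1] [1, 3, 4] h (H.move hz) k
      · exact H.tri [0, 4] [1] [1, 2, 3] (H.move h) (H.move hz) k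
  refine ⟨hz, h21, ?_⟩
  rcases H.edge_cases t [0] 1 t [] 3 1 precedes_nil with h | h | h | h
  · exact absurd h hw
  · exact absurd h hl
  · exact (H.tri [0, 1] [2] [2, 3, 4] h21 (H.move hz) h).elim
  · exact h

/-- The case in which the nodes of length one are not adjacent to the later nodes of length two. -/
theorem edges_of_not_edge_one_two {t : Bool} (h12 : ¬ E t [0] t [1, 2]) :
    E t [0] t [0, 1] ∧ E t [0, 1, 2] t [3] ∧ E t [0, 3, 4] t [1, 2] := by
  have hown := H.edge_two_three_child t
  have hw : E t [0] t [0, 1] := by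
    rcases H.edge_cases t [0] 1 t [] 2 1 precedes_nil with h | h | h | h
    · exact h
    · exact absurd h h12
    · exact absurd (H.move h) (H.not_edge_two_two_separated t)
    · exact absurd (H.move h) (H.not_edge_two_two_nested t)
  have hz : ¬ E t [0] t [0, 1, 2] := fun h => H.tri [0] [0, 1] [0, 1, 2] hw hown h
  have h31 : E t [0, 1, 2] t [3] := by
    rcases H.edge_cases t [0] 2 t [] 1 1 precedes_nil with h | h | h | h
    · exact absurd h hz
    · exact absurd h (H.not_edge_one_one t)
    · exact h
    · exfalso
      rcases H.edge_cases t [0] 2 t [1] 1 2 (precedes_of_lt Nat.zero_lt_one) with k | k | k | k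
      · exact hz (H.move k)
      · exact h12 (H.move k)
      · exact H.tri [0, 2, 3] [1] [1, 4] h (H.move hw) k
      · exact H.tri [0, 3, 4] [1] [1, 2] (H.move h) (H.move hw) k
  refine ⟨hw, h31, ?_⟩
  rcases H.edge_cases t [0] 2 t [] 2 1 precedes_nil with h | h | h | h
  · exact absurd h hz
  · exact absurd h h12
  · exact (H.tri [0, 1, 2] [3] [3, 4] h31 (H.move hw) h).elim
  · exact h

/-! ### Both trees together: no canonical graph exists. -/

/-- The three levels of the second tree are pairwise connected, so two nodes of the first tree
cannot be adjacent to all of them. -/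
theorem false_of_two_neighbourhoods (v v' : List ℕ)
    (h1 : (E false v true [10] ∧ E false v true [13]) ∨
      (E false v' true [10] ∧ E false v' true [13]))
    (h2 : (E false v true [10, 11] ∧ E false v true [11, 12]) ∨
      (E false v' true [10, 11] ∧ E false v' true [11, 12]))
    (h3 : E false v true [10, 11, 12] ∨ E false v' true [10, 11, 12]) : False := by
  have hown := H.edge_two_three_child true
  have k23 : ∀ v, E false v true [10, 11] → E false v true [10, 11, 12] → False := fun v a b =>
    H.tri v [10, 11] [10, 11, 12] a (H.move hown) b
  have k12 : ∀ v, E false v true [10] → E false v true [10, 11] → E false v true [11, 12] →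
      False := by
    intro v a b c
    by_cases h12 : E true [0] true [1, 2]
    · exact H.tri v [10] [11, 12] a (H.move h12) c
    · exact H.tri v [10] [10, 11] a (H.move (H.edges_of_not_edge_one_two h12).1) b
  have k13 : ∀ v, E false v true [10] → E false v true [13] → E false v true [10, 11, 12] →
      False := by
    intro v a b c
    by_cases h12 : E true [0] true [1, 2]
    · exact H.tri v [10] [10, 11, 12] a (H.move (H.edges_of_edge_one_two h12).1) c
    · exact H.tri v [10, 11, 12] [13] c (H.move (H.edges_of_not_edge_one_two h12).2.1) b
  -- Three levels are distributed over two nodes, so one node meets two levels.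
  rcases h1 with h1 | h1 <;> rcases h2 with h2 | h2 <;> rcases h3 with h3 | h3
  · exact k12 v h1.1 h2.1 h2.2
  · exact k12 v h1.1 h2.1 h2.2
  · exact k13 v h1.1 h1.2 h3
  · exact k23 v' h2.1 h3
  · exact k23 v h2.1 h3
  · exact k13 v' h1.1 h1.2 h3
  · exact k12 v' h1.1 h2.1 h2.2
  · exact k12 v' h1.1 h2.1 h2.2

/-- For each level of the second tree, the edges from the limit node of the first tree to it and the
edges from the first tree to late nodes or from late nodes of the first tree. -/
theorem edge_cases_top (d d' : ℕ) (hd : d = 1 ∨ d = 2 ∨ d = 3) (hd' : d' = 1 ∨ d' = 2 ∨ d' = 3)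
    (h : ¬ E false [] false (List.range' 0 d)) :
    E false [] true (List.range' 0 d') ∨
      E false (List.range' 0 d) true (List.range' d d') ∨
      E false (List.range' d' d) true (List.range' 0 d') := by
  have := H.edge_cases false [] d true [] d' 0 precedes_of_ne
    (by rcases hd with rfl | rfl | rfl <;> rcases hd' with rfl | rfl | rfl <;> decide +kernel)
  simp only [List.nil_append, Nat.zero_add] at this
  exact this.resolve_left h

theorem not_edge_one_two (h12 : E false [0] false [1, 2]) : False := by
  have hown := H.edge_two_three_child false
  obtain ⟨h13, h21, h23⟩ := H.edges_of_edge_one_two h12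
  by_cases hr : E false [] false [0, 1, 2]
  · have h1 : ¬ E false [] false [0] := fun h => H.tri [] [0] [0, 1, 2] h h13 hr
    have h2 : ¬ E false [] false [0, 1] := fun h => H.tri [] [0, 1] [0, 1, 2] h hown hr
    -- The root misses the levels of length one and two. If it also missed level `d` of the second
    -- tree, both these levels would be joined to level `d`; for each of the four relative
    -- positions, `h12` or `h21` supplies the third side of a triangle.
    have key : ∀ d, d = 1 ∨ d = 2 ∨ d = 3 → E false [] true (List.range' 0 d) := by
      intro d hd
      rcases H.edge_cases_top 1 d (by simp) hd h1 with h | h | h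
      · exact h
      all_goals rcases H.edge_cases_top 2 d (by simp) hd h2 with k | k | k
      · exact k
      · exfalso
        exact H.tri [0] [1, 2] (List.range' 3 d) h12
          (by rcases hd with rfl | rfl | rfl <;> exact H.move k)
          (by rcases hd with rfl | rfl | rfl <;> exact H.move h)
      · exfalso
        exact H.tri [0] [5, 6] (List.range' 1 d) (H.move h12)
          (by rcases hd with rfl | rfl | rfl <;> exact H.move k)
          (by rcases hd with rfl | rfl | rfl <;> exact H.move h)
      · exact k
      · exfalso
        exact H.tri [0, 1] [6] (List.range' 2 d) (H.move h21)
          (by rcases hd with rfl | rfl | rfl <;> exact H.move h)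
          (by rcases hd with rfl | rfl | rfl <;> exact H.move k)
      · exfalso
        exact H.tri [3] [4, 5] (List.range' 0 d) (H.move h12)
          (by rcases hd with rfl | rfl | rfl <;> exact H.move k)
          (by rcases hd with rfl | rfl | rfl <;> exact H.move h)
    have k1 := key 1 (by simp)
    have k2 := key 2 (by simp)
    have k3 := key 3 (by simp)
    exact H.false_of_two_neighbourhoods [] [] (Or.inl ⟨H.move k1, H.move k1⟩)
      (Or.inl ⟨H.move k2, H.move k2⟩) (Or.inl (H.move k3))
  · have key : ∀ d, d = 1 ∨ d = 2 ∨ d = 3 → E false [] true (List.range' 0 d) ∨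
        E false (List.range' d 3) true (List.range' 0 d) := by
      intro d hd
      rcases H.edge_cases_top 3 d (by simp) hd hr with h | h | h
      · exact Or.inl h
      · exfalso
        -- An early leaf joined to level `d` is impossible: every edge forced among `[0]`, its
        -- children and level `d` closes a triangle at such a leaf.
        rcases H.edge_cases false [0] 1 true [] d 1 precedes_of_ne
          (by rcases hd with rfl | rfl | rfl <;> decide +kernel) with k | k | k | k
        · exact H.tri [0] [0, 1] [0, 1, 2] k hown h13
        · exact H.tri [0] [0, 1, 2] (List.range' 3 d) h13
            h
            (by rcases hd with rfl | rfl | rfl <;> exact H.move k)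
        · exact H.tri [0, 1] [0, 1, 2] (List.range' 3 d) hown
            h
            (by rcases hd with rfl | rfl | rfl <;> exact H.move k)
        · exact H.tri [0, 7] [1, 2, 3] (List.range' 4 d) (H.move h23)
            (by rcases hd with rfl | rfl | rfl <;> exact H.move h)
            (by rcases hd with rfl | rfl | rfl <;> exact H.move k)
      · exact Or.inr h
    -- The labels exceed 10 to 13, used in the second tree, to match the late position in `key`.
    refine H.false_of_two_neighbourhoods [] [20, 21, 22] ?_ ?_ ?_
    · exact (key 1 (by simp)).imp (fun k => ⟨H.move k, H.move k⟩) fun k => ⟨H.move k, H.move k⟩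
    · exact (key 2 (by simp)).imp (fun k => ⟨H.move k, H.move k⟩) fun k => ⟨H.move k, H.move k⟩
    · exact (key 3 (by simp)).imp (fun k => H.move k) fun k => H.move k

/-- There is no canonical graph. -/
protected theorem false : False := by
  have hown := H.edge_two_three_child false
  obtain ⟨h12, h31, h32⟩ := H.edges_of_not_edge_one_two H.not_edge_one_two
  by_cases hr : E false [] false [0, 1]
  · have h1 : ¬ E false [] false [0] := fun h => H.tri [] [0] [0, 1] h h12 hr
    have h3 : ¬ E false [] false [0, 1, 2] := fun h => H.tri [] [0, 1] [0, 1, 2] hr hown h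
    have key : ∀ d, d = 1 ∨ d = 2 ∨ d = 3 → E false [] true (List.range' 0 d) ∨
        E false [0] true (List.range' 1 d) := by
      intro d hd
      rcases H.edge_cases_top 1 d (by simp) hd h1 with h | h | h
      · exact Or.inl h
      · exact Or.inr h
      -- A late node of length one joined to level `d` is ruled out: the root misses the leaves as
      -- well, so leaves are joined to level `d`, and `h31` joins leaves to later nodes of length
      -- one.
      · rcases H.edge_cases_top 3 d (by simp) hd h3 with k | k | k
        · exact Or.inl k
        · exfalso
          exact H.tri [0, 1, 2] [7] (List.range' 3 d) (H.move h31)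
            (by rcases hd with rfl | rfl | rfl <;> exact H.move h)
            (by rcases hd with rfl | rfl | rfl <;> exact H.move k)
        · exfalso
          exact H.tri [3, 4, 5] [6] (List.range' 0 d) (H.move h31)
            (by rcases hd with rfl | rfl | rfl <;> exact H.move h)
            (by rcases hd with rfl | rfl | rfl <;> exact H.move k)
    refine H.false_of_two_neighbourhoods [] [0] ?_ ?_ ?_
    · exact (key 1 (by simp)).imp (fun k => ⟨H.move k, H.move k⟩) fun k => ⟨H.move k, H.move k⟩
    · exact (key 2 (by simp)).imp (fun k => ⟨H.move k, H.move k⟩) fun k => ⟨H.move k, H.move k⟩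
    · exact (key 3 (by simp)).imp (fun k => H.move k) fun k => H.move k
  · have key : ∀ d, d = 1 ∨ d = 2 ∨ d = 3 → E false [] true (List.range' 0 d) ∨
        E false (List.range' d 2) true (List.range' 0 d) := by
      intro d hd
      rcases H.edge_cases_top 2 d (by simp) hd hr with h | h | h
      · exact Or.inl h
      · exfalso
        rcases H.edge_cases false [0] 2 true [] d 1 precedes_of_ne
          (by rcases hd with rfl | rfl | rfl <;> decide +kernel) with k | k | k | k
        · exact H.tri [0] [0, 1] [0, 1, 2] h12 hown k
        · exact H.tri [0] [0, 1] (List.range' 2 d) h12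
            h
            (by rcases hd with rfl | rfl | rfl <;> exact H.move k)
        · exact H.tri [0, 1] [0, 1, 2] (List.range' 3 d) hown
            (by rcases hd with rfl | rfl | rfl <;> exact H.move k)
            (by rcases hd with rfl | rfl | rfl <;> exact H.move h)
        · exact H.tri [0, 6, 7] [1, 2] (List.range' 3 d) (H.move h32)
            (by rcases hd with rfl | rfl | rfl <;> exact H.move h)
            (by rcases hd with rfl | rfl | rfl <;> exact H.move k)
      · exact Or.inr h
    refine H.false_of_two_neighbourhoods [] [20, 21] ?_ ?_ ?_
    · exact (key 1 (by simp)).imp (fun k => ⟨H.move k, H.move k⟩) fun k => ⟨H.move k, H.move k⟩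
    · exact (key 2 (by simp)).imp (fun k => ⟨H.move k, H.move k⟩) fun k => ⟨H.move k, H.move k⟩
    · exact (key 3 (by simp)).imp (fun k => H.move k) fun k => H.move k

end IsCanonicalGraph

/-! ### From colourings to graphs: the upper bound. -/

/-- Two ordinals below `β` form a pair of colour `1`. -/
def IsEdge {β : Ordinal.{u}} (c : Colouring β 2 (Fin 2)) (a b : Ordinal.{u}) : Prop :=
  ∃ (ha : a < β) (hb : b < β) (hab : a ≠ b),
    c ⟨{⟨a, ha⟩, ⟨b, hb⟩}, Finset.card_pair fun h => hab (congrArg Subtype.val h)⟩ = 1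

theorem IsEdge.symm {β : Ordinal.{u}} {c : Colouring β 2 (Fin 2)} {a b : Ordinal.{u}}
    (h : IsEdge c a b) : IsEdge c b a := by
  obtain ⟨ha, hb, hab, h⟩ := h
  refine ⟨hb, ha, hab.symm, ?_⟩
  rw [← h]
  congr 2
  exact Finset.pair_comm _ _

theorem homogeneous_one_iff {β : Ordinal.{u}} {c : Colouring β 2 (Fin 2)} {X : Set Ordinal.{u}}
    (hX : X ⊆ Set.Iio β) :
    Homogeneous c X 1 ↔ ∀ a ∈ X, ∀ b ∈ X, a ≠ b → IsEdge c a b := by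
  constructor
  · intro h a ha b hb hab
    refine ⟨hX ha, hX hb, hab, h _ ?_⟩
    simp only [Finset.mem_insert, Finset.mem_singleton]
    rintro γ (rfl | rfl)
    · exact ha
    · exact hb
  · rintro h ⟨s, hs⟩ hsX
    obtain ⟨a, b, hab, rfl⟩ := Finset.card_eq_two.1 hs
    obtain ⟨_, _, _, h⟩ := h a (hsX a (by simp)) b (hsX b (by simp)) (Subtype.coe_ne_coe.2 hab)
    exact h

theorem homogeneous_zero_iff {β : Ordinal.{u}} {c : Colouring β 2 (Fin 2)} {X : Set Ordinal.{u}} :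
    Homogeneous c X 0 ↔ ∀ a ∈ X, ∀ b ∈ X, ¬ IsEdge c a b := by
  constructor
  · rintro h a ha b hb ⟨ha', hb', hab, h'⟩
    rw [h _ (by
      simp only [Finset.mem_insert, Finset.mem_singleton]
      rintro γ (rfl | rfl)
      · exact ha
      · exact hb)] at h'
    exact absurd h' (by decide)
  · rintro h ⟨s, hs⟩ hsX
    obtain ⟨a, b, hab, rfl⟩ := Finset.card_eq_two.1 hs
    have h1 := h a (hsX a (by simp)) b (hsX b (by simp))
    by_contra h0
    exact h1 ⟨a.2, b.2, Subtype.coe_ne_coe.2 hab, Fin.eq_one_of_ne_zero _ h0⟩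

theorem point_lt_mul_two (t : Bool) (a : ℕ) (l : List ℕ) :
    (point t (a :: l) : Ordinal.{u}) < ω ^ 3 * 2 := by
  rw [point, ← one_add_one_eq_two, mul_add_one, mul_one]
  refine add_lt_add_of_le_of_lt ?_ (nodeVal_cons_lt_cube a l)
  cases t
  · exact zero_le
  · exact le_rfl

/-- Labels of `s` are below `c ≤ a`; this settles the comparison whenever the words part at the new
label `h a`. -/
theorem point_lt_point_of_precedes {t t' : Bool} {s s' l : List ℕ} {c a : ℕ} {h : ℕ → ℕ}
    (hh : StrictMono h) (hp : Precedes t s t' s') (hs : ∀ x ∈ s, x < c) (ha : c ≤ a)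
    (hl : s.length ≤ 2) (hl' : s'.length + l.length ≤ 2) :
    (point t (s.map h) : Ordinal.{u}) < point t' (s'.map h ++ h a :: l) := by
  rcases hp with ⟨rfl, rfl⟩ | ⟨rfl, b, m, rfl, hp⟩
  · have hpos : (0 : Ordinal.{u}) < nodeVal (s'.map h ++ h a :: l) := by
      match s' with
      | [] => exact (zero_le).trans_lt (lt_nodeVal_first (b := h a) (l := l) (by simpa using hl'))
      | b :: m =>
        exact (zero_le).trans_lt
          (lt_nodeVal_first (b := h b) (l := m.map h ++ h a :: l) (by simp at hl' ⊢; omega))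
    simp only [point, cond_false, cond_true, zero_add]
    exact (nodeVal_le_cube _).trans_lt (lt_add_of_pos_right _ hpos)
  · refine (add_lt_add_iff_left _).2 ?_
    rcases hp with rfl | ⟨b', m', rfl, hb⟩ | ⟨rfl, hm⟩
    · exact nodeVal_lt_of_first_lt _ (by simpa using hl')
        (hh ((hs b (by simp)).trans_le ha))
    · exact nodeVal_lt_of_first_lt _ (by simp at hl' ⊢; omega) (hh hb)
    · match m, hm with
      | k :: m, _ =>
        exact nodeVal_lt_of_second_lt (by simp only [List.length_cons, List.length_map] at hl ⊢; omega)
          (by simp only [List.length_cons, List.length_nil] at hl'; omega)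
          (hh ((hs k (by simp)).trans_le ha))

theorem point_append_lt_append {t : Bool} {s l l' : List ℕ} {a a' : ℕ} (h : a < a')
    (hl : s.length + l.length ≤ 2) (hl' : s.length + l'.length ≤ 2) :
    (point t (s ++ a :: l) : Ordinal.{u}) < point t (s ++ a' :: l') :=
  (add_lt_add_iff_left _).2 (nodeVal_append_lt_append h hl hl')

theorem isLUB_point_append {t : Bool} {s : List ℕ} {f : ℕ → ℕ} {l : ℕ → List ℕ}
    (hf : StrictMono f) (hl : ∀ n, s.length + (l n).length ≤ 2) :
    IsLUB (Set.range fun n => (point t (s ++ f n :: l n) : Ordinal.{u})) (point t s) := by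
  have h := (isNormal_add_right (bif t then ω ^ 3 else 0 : Ordinal.{u})).map_isLUB
    (isLUB_nodeVal_append hf hl) (Set.range_nonempty _)
  rwa [← Set.range_comp] at h

theorem map_append_range'_succ (h : ℕ → ℕ) (s : List ℕ) (a d : ℕ) :
    (s ++ List.range' a (d + 1)).map h = s.map h ++ h a :: (List.range' (a + 1) d).map h := by
  rw [List.map_append, List.range'_succ, List.map_cons]

theorem exists_edge_of_sequences {β : Ordinal.{u}} {c : Colouring β 2 (Fin 2)}
    (hX : ¬ ∃ X : Set Ordinal.{u}, X ⊆ Set.Iio β ∧ HasOrderType X (ω * 2) ∧ ClosedInSup X ∧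
      Homogeneous c X 0) {x y : ℕ → Ordinal.{u}} {p : Ordinal.{u}} (hx : StrictMono x)
    (hp : IsLUB (Set.range x) p) (hy : StrictMono y) (hpy : ∀ n, p < y n) (hyβ : ∀ n, y n < β) :
    (∃ n, IsEdge c p (x n)) ∨ (∃ m n, m < n ∧ IsEdge c (x m) (x n)) ∨ (∃ n, IsEdge c p (y n)) ∨
      (∃ m n, m < n ∧ IsEdge c (y m) (y n)) ∨ ∃ m n, IsEdge c (x m) (y n) := by
  by_contra! h
  obtain ⟨h1, h2, h3, h4, h5⟩ := h
  have hpβ : p < β := (hpy 0).trans (hyβ 0)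
  have hsub : Set.range x ∪ {p} ∪ Set.range y ⊆ Set.Iio β := by
    rintro _ ((⟨n, rfl⟩ | rfl) | ⟨n, rfl⟩)
    · exact (hp.1 ⟨n, rfl⟩).trans_lt hpβ
    · exact hpβ
    · exact hyβ n
  refine hX ⟨_, hsub, (exists_closedInSup_of_sequences hx hp hy hpy).1,
    (exists_closedInSup_of_sequences hx hp hy hpy).2, homogeneous_zero_iff.2 ?_⟩
  have hself : ∀ a, ¬ IsEdge c a a := fun a ⟨_, _, h, _⟩ => h rfl
  rintro _ ((⟨m, rfl⟩ | rfl) | ⟨m, rfl⟩) _ ((⟨n, rfl⟩ | rfl) | ⟨n, rfl⟩) h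
  · rcases lt_trichotomy m n with hmn | rfl | hmn
    · exact h2 m n hmn h
    · exact hself _ h
    · exact h2 n m hmn h.symm
  · exact h1 m h.symm
  · exact h5 m n h
  · exact h1 n h
  · exact hself _ h
  · exact h3 n h
  · exact h5 n m h.symm
  · exact h3 m h.symm
  · rcases lt_trichotomy m n with hmn | rfl | hmn
    · exact h4 m n hmn h
    · exact hself _ h
    · exact h4 n m hmn h.symm

theorem arrow_omega0_cube_mul_two (c : Colouring (ω ^ 3 * 2 : Ordinal.{u}) 2 (Fin 2)) :
    (∃ T : Set Ordinal.{u}, T ⊆ Set.Iio (ω ^ 3 * 2) ∧ T.encard = 3 ∧ Homogeneous c T 1) ∨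
    (∃ X : Set Ordinal.{u}, X ⊆ Set.Iio (ω ^ 3 * 2) ∧ HasOrderType X (ω * 2) ∧ ClosedInSup X ∧
      Homogeneous c X 0) := by
  by_contra! hc
  obtain ⟨hT, hX⟩ := hc
  -- Eight letters cover every use of `edge_cases`, which asks for `c + 2 * d ≤ 8`.
  obtain ⟨h, hh, hiff⟩ := exists_strictMono_forall_map_iff 8 3
    fun t I t' J => IsEdge c (point t I) (point t' J)
  let E : Bool → List ℕ → Bool → List ℕ → Prop :=
    fun t I t' J => IsEdge c (point t (I.map h)) (point t' (J.map h))
  refine IsCanonicalGraph.false (E := E) ⟨fun h => h.symm, hiff, ?_, ?_⟩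
  · rintro t t' t'' I J K h1 h2 h3
    obtain ⟨ha, hb, hab, -⟩ := id h1
    obtain ⟨-, hd, hbd, -⟩ := id h2
    obtain ⟨-, -, had, -⟩ := id h3
    have hsub : ({point t (I.map h), point t' (J.map h), point t'' (K.map h)} : Set Ordinal.{u}) ⊆
        Set.Iio (ω ^ 3 * 2) := by
      rintro _ (rfl | rfl | rfl)
      · exact ha
      · exact hb
      · exact hd
    refine hT _ hsub (Set.encard_eq_three.2 ⟨_, _, _, hab, had, hbd, rfl⟩)
      ((homogeneous_one_iff hsub).2 ?_)
    rintro _ (rfl | rfl | rfl) _ (rfl | rfl | rfl) hne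
    exacts [absurd rfl hne, h1, h3, h1.symm, absurd rfl hne, h2, h3.symm, h2.symm, absurd rfl hne]
  · intro t s d t' s' d' c₀ hd hd' hsd hsd' hs hp
    obtain ⟨d, rfl⟩ := Nat.exists_eq_add_of_le' hd
    obtain ⟨d', rfl⟩ := Nat.exists_eq_add_of_le' hd'
    -- Blocks have at most three labels. Starting them at `c₀ + 12 * n` for one sequence and `c₀ + 6
    -- + 12 * n` for the other makes all blocks disjoint, so every edge found between them is of a
    -- listed kind.
    have hmono : ∀ b, StrictMono fun n => h (b + 12 * n) := fun b m n hmn => hh (by omega)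
    have hx : StrictMono fun n =>
        (point t ((s ++ List.range' (c₀ + 12 * n) (d + 1)).map h) : Ordinal.{u}) := by
      intro m n hmn
      simp only [map_append_range'_succ]
      exact point_append_lt_append (hmono c₀ hmn) (by simp; omega) (by simp; omega)
    have hy : StrictMono fun n =>
        (point t' ((s' ++ List.range' (c₀ + 6 + 12 * n) (d' + 1)).map h) : Ordinal.{u}) := by
      intro m n hmn
      simp only [map_append_range'_succ]
      exact point_append_lt_append (hmono (c₀ + 6) hmn) (by simp; omega) (by simp; omega)
    have hlub : IsLUB (Set.range fun n =>
        (point t ((s ++ List.range' (c₀ + 12 * n) (d + 1)).map h) : Ordinal.{u}))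
        (point t (s.map h)) := by
      simp only [map_append_range'_succ]
      exact isLUB_point_append (hmono c₀) (by simp; omega)
    have hpy : ∀ n, (point t (s.map h) : Ordinal.{u}) <
        point t' ((s' ++ List.range' (c₀ + 6 + 12 * n) (d' + 1)).map h) := by
      intro n
      rw [map_append_range'_succ]
      exact point_lt_point_of_precedes hh hp hs (by omega) (by omega) (by simp; omega)
    have hyβ : ∀ n, (point t' ((s' ++ List.range' (c₀ + 6 + 12 * n) (d' + 1)).map h) :
        Ordinal.{u}) < ω ^ 3 * 2 := by
      intro n
      rw [map_append_range'_succ]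
      rcases s' with _ | ⟨b, m⟩
      · exact point_lt_mul_two _ _ _
      · exact point_lt_mul_two _ _ _
    rcases exists_edge_of_sequences (by push Not; exact hX) hx hlub hy hpy hyβ with
      ⟨n, hn⟩ | ⟨m, n, hmn, hn⟩ | ⟨n, hn⟩ | ⟨m, n, hmn, hn⟩ | ⟨m, n, hn⟩
    · exact Or.inl ⟨_, by omega, hn⟩
    · exact Or.inr (Or.inl ⟨_, _, by omega, by omega, hn⟩)
    · exact Or.inr (Or.inr (Or.inl ⟨_, by omega, hn⟩))
    · exact Or.inr (Or.inr (Or.inr (Or.inl ⟨_, _, by omega, by omega, hn⟩)))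
    · rcases Nat.lt_or_ge n m with hmn | hmn
      · exact Or.inr (Or.inr (Or.inr (Or.inr (Or.inr ⟨_, _, by omega, by omega, hn⟩))))
      · exact Or.inr (Or.inr (Or.inr (Or.inr (Or.inl ⟨_, _, by omega, by omega, hn⟩))))

/-! ### The triangle-free graph of the lower bound. -/

/-- The order of the points of a tree, in terms of the labels. -/
def NodeLT : List ℕ → List ℕ → Prop
  | [], _ => False
  | _ :: _, [] => True
  | a :: l, b :: m => a < b ∨ a = b ∧ NodeLT l m

theorem nodeLT_trichotomy : ∀ l m : List ℕ, NodeLT l m ∨ l = m ∨ NodeLT m l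
  | [], [] => by simp
  | [], _ :: _ => by simp [NodeLT]
  | _ :: _, [] => by simp [NodeLT]
  | a :: l, b :: m => by
    have := nodeLT_trichotomy l m
    simp only [NodeLT, List.cons.injEq]
    rcases lt_trichotomy a b with h | rfl | h
    · simp [h]
    · simpa using this
    · simp [h]

theorem exists_eq_append_of_nodeLT : ∀ {l m : List ℕ}, NodeLT l m →
    ∃ s a l', l = s ++ a :: l' ∧ (m = s ∨ ∃ b m', m = s ++ b :: m' ∧ a < b)
  | [], _, h => h.elim
  | a :: l, [], _ => ⟨[], a, l, rfl, Or.inl rfl⟩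
  | a :: l, b :: m, h => by
    rcases h with h | ⟨rfl, h⟩
    · exact ⟨[], a, l, rfl, Or.inr ⟨b, m, rfl, h⟩⟩
    · obtain ⟨s, a', l', rfl, rfl | ⟨b, m', rfl, hab⟩⟩ := exists_eq_append_of_nodeLT h
      · exact ⟨a :: m, a', l', rfl, Or.inl rfl⟩
      · exact ⟨a :: s, a', l', rfl, Or.inr ⟨b, m', rfl, hab⟩⟩

theorem nodeVal_lt_of_nodeLT {l m : List ℕ} (hl : l.length ≤ 3) (hm : m.length ≤ 3)
    (h : NodeLT l m) : (nodeVal l : Ordinal.{u}) < nodeVal m := by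
  obtain ⟨s, a, l', rfl, rfl | ⟨b, m', rfl, hab⟩⟩ := exists_eq_append_of_nodeLT h
  · exact nodeVal_append_lt (by simp at hl; omega)
  · exact nodeVal_append_lt_append hab (by simp at hl; omega) (by simp at hm; omega)

theorem nodeVal_lt_iff {l m : List ℕ} (hl : l.length ≤ 3) (hm : m.length ≤ 3) :
    (nodeVal l : Ordinal.{u}) < nodeVal m ↔ NodeLT l m := by
  refine ⟨fun h => ?_, nodeVal_lt_of_nodeLT hl hm⟩
  rcases nodeLT_trichotomy l m with h' | rfl | h'
  · exact h'
  · exact absurd h (lt_irrefl _)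
  · exact absurd h (nodeVal_lt_of_nodeLT hm hl h').not_gt

/-- The nonzero ordinals below `ω ^ 3 * 2`, according to their Cantor–Bendixson rank and to the side
of `ω ^ 3` on which they lie. -/
inductive Vertex
  | top
  | z (t : Bool) (b : ℕ)
  | w (t : Bool) (b k : ℕ)
  | x (t : Bool) (b k j : ℕ)

namespace Vertex

def side : Vertex → Bool
  | top => false
  | z t _ => t
  | w t _ _ => t
  | x t _ _ _ => t

def labels : Vertex → List ℕ
  | top => []
  | z _ b => [b]
  | w _ b k => [b, k]
  | x _ b k j => [b, k, j]

noncomputable def toOrdinal (v : Vertex) : Ordinal.{u} := point v.side v.labels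

theorem length_labels_le (v : Vertex) : v.labels.length ≤ 3 := by
  cases v <;> simp [labels]

theorem labels_ne_nil {v : Vertex} (h : v.side = true) : v.labels ≠ [] := by
  cases v <;> simp_all [side, labels]

theorem nodeVal_labels_pos (v : Vertex) : (0 : Ordinal.{u}) < nodeVal v.labels := by
  cases v
  · exact (zero_le).trans_lt (sq_mul_natCast_lt_cube 0)
  all_goals exact (zero_le).trans_lt (lt_nodeVal_first (by simp))

theorem toOrdinal_lt_iff {v v' : Vertex} : (v.toOrdinal : Ordinal.{u}) < v'.toOrdinal ↔
    (v.side = false ∧ v'.side = true) ∨ (v.side = v'.side ∧ NodeLT v.labels v'.labels) := by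
  have h1 : ∀ {v v' : Vertex}, v.side = false → v'.side = true →
      (v.toOrdinal : Ordinal.{u}) < v'.toOrdinal := by
    intro v v' h h'
    rw [toOrdinal, toOrdinal, point, point, h, h', cond_false, cond_true, zero_add]
    exact (nodeVal_le_cube _).trans_lt (lt_add_of_pos_right _ v'.nodeVal_labels_pos)
  rcases hs : v.side with _ | _ <;> rcases hs' : v'.side with _ | _
  · simp [toOrdinal, point, hs, hs', nodeVal_lt_iff, length_labels_le]
  · simp [h1 hs hs']
  · simp [(h1 hs' hs).le]
  · simp [toOrdinal, point, hs, hs', nodeVal_lt_iff, length_labels_le]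

theorem exists_toOrdinal_eq {a : Ordinal.{u}} (h0 : a ≠ 0) (h : a < ω ^ 3 * 2) :
    ∃ v : Vertex, v.toOrdinal = a := by
  rcases lt_trichotomy a (ω ^ 3) with ha | rfl | ha
  · rcases exists_nodeVal_eq h0 ha with ⟨b, k, j, rfl⟩ | ⟨b, k, rfl⟩ | ⟨b, rfl⟩
    · exact ⟨x false b k j, zero_add _⟩
    · exact ⟨w false b k, zero_add _⟩
    · exact ⟨z false b, zero_add _⟩
  · exact ⟨top, zero_add _⟩
  · obtain ⟨r, rfl⟩ := le_iff_exists_add.1 ha.le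
    have hr0 : r ≠ 0 := by
      rintro rfl
      simp at ha
    have hr : r < ω ^ 3 := by
      rw [← one_add_one_eq_two, mul_add_one, mul_one] at h
      exact lt_of_add_lt_add_left h
    rcases exists_nodeVal_eq hr0 hr with ⟨b, k, j, rfl⟩ | ⟨b, k, rfl⟩ | ⟨b, rfl⟩
    · exact ⟨x true b k j, rfl⟩
    · exact ⟨w true b k, rfl⟩
    · exact ⟨z true b, rfl⟩

theorem finite_setOf_labels_lt (M : ℕ) : {v : Vertex | ∀ a ∈ v.labels, a < M}.Finite := by
  have hinj : Function.Injective fun v : Vertex => (v.side, v.labels) := by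
    intro v v' h
    cases v <;> cases v' <;> simp_all [side, labels]
  refine (((Set.finite_univ (α := Bool)).prod
    (finite_setOf_length_le_and_lt 3 M)).preimage hinj.injOn).subset ?_
  intro v hv
  exact ⟨trivial, v.length_labels_le, hv⟩

/-- Half of the adjacency relation of a triangle-free graph. -/
def Rel : Vertex → Vertex → Prop
  | top, z false _ => True
  | top, x true _ _ _ => True
  | z false b, w false b' _ => b = b'
  | z false b, x false b' k' _ => b < b' ∨ b' < b ∧ k' < b
  | w false b k, x false b' k' _ => (b = b' ∧ k = k') ∨ b' < b ∧ b ≤ k'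
  | w true _ i, x false b k _ => b < i ∧ k < i
  | w true _ i, w false b _ => i ≤ b
  | x true _ i j, x false _ k _ => i ≤ k ∧ j ≤ k
  | z true n, x true n' _ _ => n = n'
  | z true n, w true m _ => n < m
  | w true n i, x true m i' j => (n = m ∧ i = i') ∨ n < m ∧ (i ≤ i' ∨ i ≤ j)
  | _, _ => False

def Adj (v v' : Vertex) : Prop := Rel v v' ∨ Rel v' v

theorem Adj.symm {v v' : Vertex} (h : Adj v v') : Adj v' v := Or.symm h

/-- The label conditions around any triple contradict each other. For `z false b`, `w false b k` and
a leaf of an earlier block, for instance, one edge needs `b ≤ k'` and another `k' < b`. -/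
theorem not_triangle {v₁ v₂ v₃ : Vertex} (h₁ : Adj v₁ v₂) (h₂ : Adj v₂ v₃) (h₃ : Adj v₁ v₃) :
    False := by
  rcases v₁ with _ | ⟨_ | _, _⟩ | ⟨_ | _, _, _⟩ | ⟨_ | _, _, _, _⟩ <;>
  rcases v₂ with _ | ⟨_ | _, _⟩ | ⟨_ | _, _, _⟩ | ⟨_ | _, _, _, _⟩ <;>
  simp only [Adj, Rel, or_false, false_or, or_self] at h₁ <;>
  rcases v₃ with _ | ⟨_ | _, _⟩ | ⟨_ | _, _, _⟩ | ⟨_ | _, _, _, _⟩ <;>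
  simp only [Adj, Rel, or_false, false_or, or_self] at h₂ h₃ <;>
  omega

end Vertex

/-! ### Every candidate copy contains an edge. -/

namespace Vertex

/-- The order of the vertices as ordinals. -/
def Before (v v' : Vertex) : Prop :=
  (v.side = false ∧ v'.side = true) ∨ (v.side = v'.side ∧ NodeLT v.labels v'.labels)

section Order

variable {v : Vertex} {N : ℕ}

/-- Leaves of the second tree are adjacent to `ω ^ 3`, and a node of length one there has only its
bounded first label. -/
theorem eq_w_of_before_top (h : Before top v) (ha : ¬ Adj top v)
    (hN : v.side = true → v.labels.headD 0 < N) (hl : ¬ ∀ a ∈ v.labels, a < N) :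
    ∃ m i, v = w true m i := by
  rcases v with _ | ⟨_ | _, _⟩ | ⟨_ | _, _, _⟩ | ⟨_ | _, _, _, _⟩
  all_goals simp [Before, side, labels, NodeLT, Adj, Rel] at h ha hN hl ⊢
  omega

theorem eq_x_of_before_top {m i : ℕ} (h : Before v top) (hi : Before (z false i) v)
    (ha : ¬ Adj top v) (hw : ¬ Adj v (w true m i)) : ∃ b k j, v = x false b k j := by
  rcases v with _ | ⟨_ | _, _⟩ | ⟨_ | _, _, _⟩ | ⟨_ | _, _, _, _⟩
  all_goals simp [Before, side, labels, NodeLT, Adj, Rel] at h hi ha hw ⊢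
  omega

theorem adj_x_of_before_top {b k j : ℕ} (h : Before top v) (ha : ¬ Adj top v)
    (hN : v.side = true → v.labels.headD 0 < N) (hl : ¬ ∀ a ∈ v.labels, a < b + k + N + 1) :
    Adj (x false b k j) v := by
  rcases v with _ | ⟨_ | _, _⟩ | ⟨_ | _, _, _⟩ | ⟨_ | _, _, _, _⟩
  all_goals simp [Before, side, labels, NodeLT, Adj, Rel] at h ha hN hl ⊢
  all_goals omega

theorem eq_x_of_before_z {b K : ℕ} (h : Before v (z false b)) (hK : Before (w false b K) v)
    (ha : ¬ Adj (z false b) v) : ∃ k j, K < k ∧ v = x false b k j := by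
  rcases v with _ | ⟨_ | _, _⟩ | ⟨_ | _, _, _⟩ | ⟨_ | _, _, _, _⟩
  all_goals simp [Before, side, labels, NodeLT, Adj, Rel] at h hK ha ⊢
  all_goals omega

/-- Two leaves are needed: nodes `w false` of later blocks and leaves of the second tree see only
leaves whose middle label is large compared with their own labels. The other possible `v` see the
fixed leaf because of their large label. -/
theorem adj_x_of_before_z {b k j : ℕ} (h : Before (z false b) v) (ha : ¬ Adj (z false b) v)
    (hN : v.side = true → v.labels.headD 0 < N) (hl : ¬ ∀ a ∈ v.labels, a < b + k + N + 1) :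
    ∃ K, ∀ k' j', K < k' → Adj (x false b k j) v ∨ Adj (x false b k' j') v := by
  refine ⟨v.labels.sum, fun k' j' hk => ?_⟩
  rcases v with _ | ⟨_ | _, _⟩ | ⟨_ | _, _, _⟩ | ⟨_ | _, _, _, _⟩
  all_goals simp [Before, side, labels, NodeLT, Adj, Rel] at h ha hN hl hk ⊢
  all_goals omega

theorem eq_w_of_before_z {b : ℕ} (h : Before v (z true b)) (h0 : Before (w true b 0) v)
    (ha : ¬ Adj (z true b) v) : ∃ i, v = w true b i := by
  rcases v with _ | ⟨_ | _, _⟩ | ⟨_ | _, _, _⟩ | ⟨_ | _, _, _, _⟩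
  all_goals simp [Before, side, labels, NodeLT, Adj, Rel] at h h0 ha ⊢
  all_goals omega

/-- Only later leaves survive; as the first label is bounded, the large label is one of the two that
`Rel` compares with `i`. -/
theorem adj_w_of_before_z {b i : ℕ} (h : Before (z true b) v) (ha : ¬ Adj (z true b) v)
    (hN : v.side = true → v.labels.headD 0 < N) (hl : ¬ ∀ a ∈ v.labels, a < i + N + 1) :
    Adj (w true b i) v := by
  rcases v with _ | ⟨_ | _, _⟩ | ⟨_ | _, _, _⟩ | ⟨_ | _, _, _, _⟩
  all_goals simp [Before, side, labels, NodeLT, Adj, Rel] at h ha hN hl ⊢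
  all_goals omega

theorem adj_w_of_before_w {t : Bool} {b k : ℕ} (h : Before v (w t b k))
    (h0 : Before (x t b k 0) v) : Adj (w t b k) v := by
  rcases t with _ | _
  all_goals rcases v with _ | ⟨_ | _, _⟩ | ⟨_ | _, _, _⟩ | ⟨_ | _, _, _, _⟩
  all_goals simp [Before, side, labels, NodeLT, Adj, Rel] at h h0 ⊢
  all_goals omega

end Order

/-- The first label of a vertex above `ω ^ 3` is bounded in terms of an upper bound of the vertex. -/
theorem headD_labels_lt {v : Vertex} {N : ℕ}
    (h : (v.toOrdinal : Ordinal.{u}) < ω ^ 3 + ω ^ 2 * N) (hs : v.side = true) :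
    v.labels.headD 0 < N := by
  obtain ⟨b, l, hl⟩ := List.exists_cons_of_ne_nil (labels_ne_nil hs)
  rw [hl, List.headD_cons]
  by_contra! hN
  have h1 : (ω ^ 2 * N : Ordinal.{u}) ≤ ω ^ 2 * b := by gcongr
  have hlen := v.length_labels_le
  rw [hl, List.length_cons] at hlen
  have h2 : (ω ^ 2 * b : Ordinal.{u}) < nodeVal (b :: l) := lt_nodeVal_first (by omega)
  rw [toOrdinal, point, hs, hl, cond_true] at h
  exact absurd (lt_of_add_lt_add_left h) (h1.trans_lt h2).not_gt

/-- The graph has no independent set consisting of a sequence, its limit and a later sequence. -/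
theorem exists_adj {xs ys : ℕ → Vertex} {p : Vertex} {N : ℕ}
    (hx : StrictMono fun n => (toOrdinal (xs n) : Ordinal.{u}))
    (hp : IsLUB (Set.range fun n => (toOrdinal (xs n) : Ordinal.{u})) p.toOrdinal)
    (hy : StrictMono fun n => (toOrdinal (ys n) : Ordinal.{u}))
    (hpy : ∀ n, (p.toOrdinal : Ordinal.{u}) < toOrdinal (ys n))
    (hN : ∀ n, (toOrdinal (ys n) : Ordinal.{u}) < ω ^ 3 + ω ^ 2 * N)
    (hpx : ∀ n, ¬ Adj p (xs n)) (hpy' : ∀ n, ¬ Adj p (ys n))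
    (hxy : ∀ m n, ¬ Adj (xs m) (ys n)) : False := by
  have hxp : ∀ n, (toOrdinal (xs n) : Ordinal.{u}) < p.toOrdinal := fun n =>
    (hx (Nat.lt_succ_self n)).trans_le (hp.1 ⟨n + 1, rfl⟩)
  have hex : ∀ v : Vertex, (v.toOrdinal : Ordinal.{u}) < p.toOrdinal →
      ∃ n, (v.toOrdinal : Ordinal.{u}) < toOrdinal (xs n) := by
    intro v hv
    obtain ⟨_, ⟨n, rfl⟩, h, -⟩ := hp.exists_between hv
    exact ⟨n, h⟩
  have hN' : ∀ n, (ys n).side = true → (ys n).labels.headD 0 < N := fun n => headD_labels_lt (hN n)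
  -- Only finitely many vertices have all labels below `M`, and the `ys n` are distinct.
  have hlarge : ∀ M, ∃ n, ¬ ∀ a ∈ (ys n).labels, a < M := by
    intro M
    by_contra! h
    have hinj : Function.Injective ys := fun m n hmn => hy.injective (by simp only [hmn])
    exact Set.infinite_of_injective_forall_mem (s := {v : Vertex | ∀ a ∈ v.labels, a < M}) hinj h
      (finite_setOf_labels_lt M)
  rcases p with _ | ⟨_ | _, b⟩ | ⟨t, b, k⟩ | ⟨t, b, k, j⟩
  · obtain ⟨n₁, hn₁⟩ := hlarge N
    obtain ⟨m, i, hi⟩ :=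
      eq_w_of_before_top (toOrdinal_lt_iff.1 (hpy n₁)) (hpy' n₁) (hN' n₁) hn₁
    obtain ⟨n₂, hn₂⟩ := hex (z false i)
      (toOrdinal_lt_iff.2 (by simp [side, labels, NodeLT]))
    obtain ⟨b, k, j, hb⟩ := eq_x_of_before_top (toOrdinal_lt_iff.1 (hxp n₂))
      (toOrdinal_lt_iff.1 hn₂) (hpx n₂) (hi ▸ hxy n₂ n₁)
    obtain ⟨n₃, hn₃⟩ := hlarge (b + k + N + 1)
    exact hxy n₂ n₃ (hb ▸ adj_x_of_before_top (toOrdinal_lt_iff.1 (hpy n₃)) (hpy' n₃) (hN' n₃) hn₃)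
  · have key : ∀ K, ∃ n k j, K < k ∧ xs n = x false b k j := by
      intro K
      obtain ⟨n, hn⟩ := hex (w false b K) (toOrdinal_lt_iff.2 (by simp [side, labels, NodeLT]))
      exact ⟨n, eq_x_of_before_z (toOrdinal_lt_iff.1 (hxp n)) (toOrdinal_lt_iff.1 hn) (hpx n)⟩
    obtain ⟨n₁, k, j, -, hk⟩ := key 0
    obtain ⟨n₂, hn₂⟩ := hlarge (b + k + N + 1)
    obtain ⟨K, hK⟩ := adj_x_of_before_z (j := j) (toOrdinal_lt_iff.1 (hpy n₂)) (hpy' n₂) (hN' n₂) hn₂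
    obtain ⟨n₃, k', j', hKk, hk'⟩ := key K
    rcases hK k' j' hKk with h | h
    · exact hxy n₁ n₂ (hk ▸ h)
    · exact hxy n₃ n₂ (hk' ▸ h)
  · obtain ⟨n₁, hn₁⟩ := hex (w true b 0) (toOrdinal_lt_iff.2 (by simp [side, labels, NodeLT]))
    obtain ⟨i, hi⟩ := eq_w_of_before_z (toOrdinal_lt_iff.1 (hxp n₁)) (toOrdinal_lt_iff.1 hn₁)
      (hpx n₁)
    obtain ⟨n₂, hn₂⟩ := hlarge (i + N + 1)
    exact hxy n₁ n₂ (hi ▸ adj_w_of_before_z (toOrdinal_lt_iff.1 (hpy n₂)) (hpy' n₂) (hN' n₂) hn₂)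
  · obtain ⟨n, hn⟩ := hex (x t b k 0) (toOrdinal_lt_iff.2 (by simp [side, labels, NodeLT]))
    exact hpx n (adj_w_of_before_w (toOrdinal_lt_iff.1 (hxp n)) (toOrdinal_lt_iff.1 hn))
  -- A leaf is a successor ordinal, hence not the limit of a strictly increasing sequence.
  · have hsucc : ((x t b k j).toOrdinal : Ordinal.{u}) =
        (bif t then ω ^ 3 else 0) + (ω ^ 2 * b + ω * k + j) + 1 := by
      simp only [toOrdinal, point, side, labels, nodeVal, add_assoc]
    refine absurd ((isLUB_le_iff (b := (bif t then ω ^ 3 else 0) + (ω ^ 2 * b + ω * k + j)) hp).2 ?_) ?_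
    · rintro _ ⟨n, rfl⟩
      have := hxp n
      rw [hsucc] at this
      exact Order.lt_add_one_iff.1 this
    · rw [hsucc, not_le]
      exact Order.lt_add_one_iff.2 le_rfl

end Vertex

/-! ### The lower bound and the conclusion. -/

theorem exists_le_add_mul_natCast {β : Ordinal.{u}} (h : β < ω ^ 3 * 2) :
    ∃ N : ℕ, β ≤ ω ^ 3 + ω ^ 2 * N := by
  rw [← one_add_one_eq_two, mul_add_one, mul_one] at h
  nth_rewrite 2 [pow_succ] at h
  obtain ⟨N, hN⟩ := lt_add_mul_omega0 h
  exact ⟨N, hN.le⟩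

theorem not_arrow_of_lt_omega0_cube_mul_two {β : Ordinal.{u}} (hβ : β < ω ^ 3 * 2) :
    ∃ c : Colouring β 2 (Fin 2),
      (¬ ∃ T : Set Ordinal.{u}, T ⊆ Set.Iio β ∧ T.encard = 3 ∧ Homogeneous c T 1) ∧
      ¬ ∃ X : Set Ordinal.{u}, X ⊆ Set.Iio β ∧ HasOrderType X (ω * 2) ∧ ClosedInSup X ∧
        Homogeneous c X 0 := by
  classical
  -- The ordinal 0 is no vertex and gets an arbitrary one. This is harmless for triangles, since
  -- `Vertex.not_triangle` does not ask for distinct vertices.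
  have hv : ∀ a : Ordinal.{u}, ∃ v : Vertex, a ≠ 0 → a < ω ^ 3 * 2 → v.toOrdinal = a := by
    intro a
    by_cases h : a ≠ 0 ∧ a < ω ^ 3 * 2
    · obtain ⟨v, hv⟩ := Vertex.exists_toOrdinal_eq h.1 h.2
      exact ⟨v, fun _ _ => hv⟩
    · exact ⟨Vertex.top, fun h1 h2 => absurd ⟨h1, h2⟩ h⟩
  choose g hg using hv
  let c : Colouring β 2 (Fin 2) := fun s =>
    if ∀ a ∈ s.1, ∀ b ∈ s.1, a ≠ b → (g a).Adj (g b) then 1 else 0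
  have hc : ∀ a b, IsEdge c a b ↔ a < β ∧ b < β ∧ a ≠ b ∧ (g a).Adj (g b) := by
    intro a b
    constructor
    · rintro ⟨ha, hb, hab, h⟩
      refine ⟨ha, hb, hab, ?_⟩
      by_contra hn
      have h0 : c ⟨{⟨a, ha⟩, ⟨b, hb⟩}, Finset.card_pair fun h => hab (congrArg Subtype.val h)⟩ = 0 :=
        if_neg fun h' => hn (h' ⟨a, ha⟩ (by simp) ⟨b, hb⟩ (by simp)
          fun h => hab (congrArg Subtype.val h))
      rw [h0] at h
      exact absurd h (by decide)
    · rintro ⟨ha, hb, hab, h⟩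
      refine ⟨ha, hb, hab, if_pos ?_⟩
      intro a' ha' b' hb' hne
      simp only [Finset.mem_insert, Finset.mem_singleton] at ha' hb'
      rcases ha' with rfl | rfl <;> rcases hb' with rfl | rfl
      · exact absurd rfl hne
      · exact h
      · exact h.symm
      · exact absurd rfl hne
  refine ⟨c, ?_, ?_⟩
  · rintro ⟨T, hTβ, hT, hom⟩
    rw [homogeneous_one_iff hTβ] at hom
    obtain ⟨a, b, d, hab, had, hbd, rfl⟩ := Set.encard_eq_three.1 hT
    exact Vertex.not_triangle ((hc _ _).1 (hom a (by simp) b (by simp) hab)).2.2.2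
      ((hc _ _).1 (hom b (by simp) d (by simp) hbd)).2.2.2
      ((hc _ _).1 (hom a (by simp) d (by simp) had)).2.2.2
  · rintro ⟨X, hXβ, hX, hXc, hom⟩
    rw [homogeneous_zero_iff] at hom
    obtain ⟨x, p, y, hx, hp, hy, hpy, hxX, hpX, hyX⟩ := exists_sequences_of_closedInSup hX hXc
    obtain ⟨N, hN⟩ := exists_le_add_mul_natCast hβ
    have hxp : ∀ n, x n < p := fun n => (hx (Nat.lt_succ_self n)).trans_le (hp.1 ⟨n + 1, rfl⟩)
    have hgX : ∀ a ∈ X, a ≠ 0 → (g a).toOrdinal = a := fun a ha h0 =>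
      hg a h0 ((hXβ ha).trans hβ)
    -- The shift discards `x 0`, which may be 0.
    have hgx : ∀ n, (g (x (n + 1))).toOrdinal = x (n + 1) := fun n =>
      hgX _ (hxX _) ((zero_le).trans_lt (hx (Nat.succ_pos n))).ne'
    have hgp : (g p).toOrdinal = p := hgX _ hpX ((zero_le).trans_lt (hxp 0)).ne'
    have hgy : ∀ n, (g (y n)).toOrdinal = y n := fun n =>
      hgX _ (hyX _) ((zero_le).trans_lt (hpy n)).ne'
    have hadj : ∀ a ∈ X, ∀ b ∈ X, a ≠ b → ¬ (g a).Adj (g b) := fun a ha b hb hab h =>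
      hom a ha b hb ((hc a b).2 ⟨hXβ ha, hXβ hb, hab, h⟩)
    refine Vertex.exists_adj.{u} (xs := fun n => g (x (n + 1))) (ys := fun n => g (y n)) (p := g p)
      (N := N) ?_ ?_ ?_ ?_ ?_ ?_ ?_ ?_
    · simp only [hgx]
      exact fun m n hmn => hx (Nat.succ_lt_succ hmn)
    · simp only [hgx, hgp]
      refine ⟨?_, fun b hb => hp.2 ?_⟩
      · rintro _ ⟨n, rfl⟩
        exact (hxp _).le
      · rintro _ ⟨n, rfl⟩
        exact (hx (Nat.lt_succ_self n)).le.trans (hb ⟨n, rfl⟩)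
    · simpa only [hgy] using hy
    · simpa only [hgy, hgp] using hpy
    · intro n
      rw [hgy]
      exact (hXβ (hyX n)).trans_le hN
    · exact fun n => hadj _ hpX _ (hxX _) (hxp _).ne'
    · exact fun n => hadj _ hpX _ (hyX _) (hpy _).ne
    · exact fun m n => hadj _ (hxX _) _ (hyX _) ((hxp _).trans (hpy _)).ne

theorem closedArrow_omega0_mul_two_three_iff {β : Ordinal.{u}} :
    ClosedArrow β (![ω * 2, 3] : Fin 2 → Ordinal.{u}) 2 ↔ ∀ c : Colouring β 2 (Fin 2),
      (∃ T : Set Ordinal.{u}, T ⊆ Set.Iio β ∧ T.encard = 3 ∧ Homogeneous c T 1) ∨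
      (∃ X : Set Ordinal.{u}, X ⊆ Set.Iio β ∧ HasOrderType X (ω * 2) ∧ ClosedInSup X ∧
        Homogeneous c X 0) := by
  refine forall_congr' fun c => ?_
  rw [Fin.exists_fin_two, or_comm]
  simp only [Matrix.cons_val_zero, Matrix.cons_val_one]
  refine or_congr (exists_congr fun T => and_congr_right fun _ => ?_) Iff.rfl
  rw [hasOrderType_three_iff]
  refine and_congr_right fun hT => and_iff_right ?_
  exact Set.Finite.closedInSup (Set.finite_of_encard_eq_coe (k := 3) (by simpa using hT))

theorem mainTheorem1 :
    IsClosedRamseyNumber (![ω * 2, 3] : Fin 2 → Ordinal.{u}) 2 (ω ^ 3 * 2) ∧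
    IsLeast
      {β : Ordinal.{u} | ∀ c : Colouring β 2 (Fin 2),
        (∃ T : Set Ordinal.{u}, T ⊆ Set.Iio β ∧ T.encard = 3 ∧ Homogeneous c T 1) ∨
        (∃ X : Set Ordinal.{u}, X ⊆ Set.Iio β ∧ HasOrderType X (ω * 2) ∧ ClosedInSup X ∧
          Homogeneous c X 0)}
      (ω ^ 3 * 2) := by
  have h : IsLeast
      {β : Ordinal.{u} | ∀ c : Colouring β 2 (Fin 2),
        (∃ T : Set Ordinal.{u}, T ⊆ Set.Iio β ∧ T.encard = 3 ∧ Homogeneous c T 1) ∨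
        (∃ X : Set Ordinal.{u}, X ⊆ Set.Iio β ∧ HasOrderType X (ω * 2) ∧ ClosedInSup X ∧
          Homogeneous c X 0)}
      (ω ^ 3 * 2) := by
    refine ⟨arrow_omega0_cube_mul_two, fun β hβ => ?_⟩
    by_contra! hlt
    obtain ⟨c, h1, h2⟩ := not_arrow_of_lt_omega0_cube_mul_two hlt
    exact (hβ c).elim h1 h2
  refine ⟨?_, h⟩
  unfold IsClosedRamseyNumber
  simp only [closedArrow_omega0_mul_two_three_iff]
  exact h
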